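/- Let $A\in\mathbb{C}[x]$ be $1$ or a product of cyclotomic polynomials (repetitions allowed), reciprocal (i.e. $A(x)=x^{\deg A}A(1/x)$) and of even degree. For $d\ge \deg A$ put $C_d(x)=x^{d}A(1/x)$. For $k\in\mathbb{C}$ consider the three types of polynomials $$\text{(type 1)}\quad P_k=A(x)y^2+\big(B(x)+k(x^4+x)+l(x^3+x^2)\big)y+C_5(x),$$ $$\text{(type 2)}\quad P_k=A(x)y^2+\big(B(x)+k(x^5+x)+l(x^4+x^2)+mx^3\big)y+C_6(x),$$ $$\text{(type 3)}\quad P_k=A(x)y^2+\big(B(x)+2a(x^7+x)+k(x^6+x^2)+l(x^5+x^3)+mx^4\big)y+C_8(x).$$ Assume one of the following. 1. $P_k$ is of type 1, $(x+1)\nmid A$, $A(1)\ne 0$, $l=-k-B(1)/2+\delta A(1)$ with $\delta=\pm1$, and either $B=0$ and $\deg A=4$, or $B=x^5+1$ and $\deg A\in\{0,2,4\}$. 2. $P_k$ is of type 2, $A(\pm1)\neq0$, $l=\frac{-B(1)+\delta_1A(1)+\delta_2A(-1)}{2}$ and $m=-2k+\delta_1A(1)-\delta_2A(-1)$ with $\delta_1=\pm1$,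 $\delta_2=\pm1$, and either $B\in\{0,\,2x^6+2\}$ and $\deg A=6$, or $B=x^6+1$ and $\deg A\in\{0,2,4,6\}$. 3. $P_k$ is of type 3, $\deg A=8$, $B=2x^8+2$, $a$ is the coefficient of $x$ in $A(x)$, $A(\pm1)\ne0$, $l=\frac{-4a+\delta_1A(1)+\delta_2A(-1)}{2}$ and $m=-2k-4+\delta_1A(1)-\delta_2A(-1)$ with $\delta_1=\pm1$, $\delta_2=\pm1$. Then for every $k\in\mathbb{C}$ the polynomial $P_k$ is tempered (all roots of the face polynomials of the sides of its Newton polygon are roots of unity) and reciprocal ($P_k(x,y)=x^{r}y^{s}P_k(1/x,1/y)$ for some integers $r,s\ge 0$). Moreover, for all but finitely many $k\in\mathbb{C}$, $P_k$ is irreducible in $\mathbb{C}[x,y]$, the curve $Z_k$ (the normalization of the projective closure of $P_k(x,y)=0$) has genus $3$, $\sigma:(x,y)\mapsto(1/x,1/y)$ is an automorphism of $Z_k$, and the quotient curve $Z_k/\langle\sigma\rangle$ has genus $1$. -/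

import Mathlib

open Polynomial
open scoped Polynomial.Bivariate

noncomputable section

namespace Genus3

/-! ### Newton polygons, tempered and reciprocal polynomials -/

/-- The coefficient of `x ^ i * y ^ j` in `P(x, y)`, for arbitrary integers `i`, `j`
(it is `0` if one of them is negative). The inner variable of `ℂ[X][Y]` is `x`, the outer
one is `y`. -/
def coeffAt (P : ℂ[X][Y]) (z : ℤ × ℤ) : ℂ :=
  if 0 ≤ z.1 ∧ 0 ≤ z.2 then (P.coeff z.2.toNat).coeff z.1.toNat else 0

/-- `IsSide P p v N`: the segment from `p` to `p + N • v` is a side (one-dimensional face) of the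
Newton polygon of `P`, i.e. of the convex hull of all `z` with `coeffAt P z ≠ 0`.
Here `v` is a primitive lattice vector, so that the lattice points of the side are
`p, p + v, …, p + N • v`. The polygon lies to the left of the directed line through `p` with
direction `v`, and it meets this line exactly in the segment. -/
structure IsSide (P : ℂ[X][Y]) (p v : ℤ × ℤ) (N : ℕ) : Prop where
  primitive : Int.gcd v.1 v.2 = 1
  length_pos : 0 < N
  start_mem : coeffAt P p ≠ 0
  end_mem : coeffAt P (p + N • v) ≠ 0
  left : ∀ z, coeffAt P z ≠ 0 → 0 ≤ v.1 * (z.2 - p.2) - v.2 * (z.1 - p.1)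
  on_line : ∀ z, coeffAt P z ≠ 0 → v.1 * (z.2 - p.2) - v.2 * (z.1 - p.1) = 0 →
    ∃ n : ℕ, n ≤ N ∧ z = p + n • v

/-- The face polynomial of the side from `p` to `p + N • v`: its coefficients are the
coefficients of `P` at the consecutive lattice points of the side. -/
def facePolynomial (P : ℂ[X][Y]) (p v : ℤ × ℤ) (N : ℕ) : ℂ[X] :=
  ∑ n ∈ Finset.range (N + 1), C (coeffAt P (p + n • v)) * X ^ n

/-- `P` is tempered: all roots of all its face polynomials are roots of unity. -/
def IsTempered (P : ℂ[X][Y]) : Prop :=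
  ∀ (p v : ℤ × ℤ) (N : ℕ), IsSide P p v N →
    ∀ t : ℂ, (facePolynomial P p v N).IsRoot t → ∃ n : ℕ, 0 < n ∧ t ^ n = 1

/-- `P` is reciprocal: `P(x, y) = x ^ m * y ^ n * P(1 / x, 1 / y)` for some `m`, `n`. -/
def IsReciprocal (P : ℂ[X][Y]) : Prop :=
  ∃ m n : ℕ, ∀ z : ℤ × ℤ, coeffAt P z = coeffAt P ((m : ℤ) - z.1, (n : ℤ) - z.2)

/-! ### The genus of a function field -/

section Genus

variable (k F : Type) [Field k] [Field F] [Algebra k F]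

/-- The differentials of `F / k` that are regular at every place. A place of a function field
`F / k` is a valuation subring `O` of `F` containing `k` (the trivial one `O = F` imposes no
condition), and `ω` is regular at `O` if it lies in the `O`-module generated by all `db`, `b ∈ O`,
i.e. in the image of `Ω[O⁄k]`. This module is the `k`-span of all `a db` with `a, b ∈ O`. -/
def regularDifferentials : Submodule k (Ω[F⁄k]) :=
  ⨅ (O : ValuationSubring F) (_ : ∀ c : k, algebraMap k F c ∈ O),
    Submodule.span k {ω | ∃ a ∈ O, ∃ b ∈ O, ω = a • KaehlerDifferential.D k F b}

/-- The genus of (the smooth projective model of) a function field in one variable over an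
algebraically closed field of characteristic zero: the dimension of its space of everywhere
regular differentials. -/
def genus : ℕ := Module.finrank k (regularDifferentials k F)

end Genus

/-! ### The curve of an irreducible polynomial and its quotient by `(x, y) ↦ (1 / x, 1 / y)` -/

theorem adjoinRoot_isDomain {P : ℂ[X][Y]} (h : Irreducible P) : IsDomain (AdjoinRoot P) :=
  AdjoinRoot.isDomain_of_prime h.prime

instance (P : ℂ[X][Y]) [Fact (Irreducible P)] : IsDomain (AdjoinRoot P) :=
  adjoinRoot_isDomain Fact.out

/-- The function field of the curve `P(x, y) = 0`, i.e. the fraction field of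
`ℂ[x, y] / (P)`. -/
abbrev FunctionField (P : ℂ[X][Y]) : Type := FractionRing (AdjoinRoot P)

/-- The function `x` on the curve `P(x, y) = 0`. -/
def xFun (P : ℂ[X][Y]) : FunctionField P :=
  algebraMap (AdjoinRoot P) (FunctionField P) (AdjoinRoot.of P X)

/-- The function `y` on the curve `P(x, y) = 0`. -/
def yFun (P : ℂ[X][Y]) : FunctionField P :=
  algebraMap (AdjoinRoot P) (FunctionField P) (AdjoinRoot.root P)

/-- `P` is irreducible and the normalization of the projective closure of the curve
`P(x, y) = 0` has genus `g`. -/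
def DefinesCurveOfGenus (P : ℂ[X][Y]) (g : ℕ) : Prop :=
  ∃ h : Irreducible P,
    haveI : Fact (Irreducible P) := ⟨h⟩
    genus ℂ (FunctionField P) = g

/-- `P` is irreducible, `σ : (x, y) ↦ (1 / x, 1 / y)` is an automorphism of the curve
`Z : P(x, y) = 0`, and the quotient curve `Z / ⟨σ⟩` has genus `g`. The function field of
`Z / ⟨σ⟩` is the fixed field of `⟨σ⟩` in the function field of `Z`. -/
def QuotientHasGenus (P : ℂ[X][Y]) (g : ℕ) : Prop :=
  ∃ h : Irreducible P,
    haveI : Fact (Irreducible P) := ⟨h⟩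
    ∃ σ : FunctionField P ≃ₐ[ℂ] FunctionField P,
      σ (xFun P) = (xFun P)⁻¹ ∧ σ (yFun P) = (yFun P)⁻¹ ∧
      genus ℂ (IntermediateField.fixedField (Subgroup.zpowers σ)) = g

/-- The condition on a family `P_k`, `k ∈ ℂ`: every `P_k` is tempered and reciprocal, and for all
but finitely many `k` it defines a curve of genus 3 whose quotient by
`(x, y) ↦ (1 / x, 1 / y)` has genus 1. -/
structure Condition (P : ℂ → ℂ[X][Y]) : Prop where
  tempered : ∀ k, IsTempered (P k)
  reciprocal : ∀ k, IsReciprocal (P k)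
  genus_three : {k | ¬ DefinesCurveOfGenus (P k) 3}.Finite
  quotient_genus_one : {k | ¬ QuotientHasGenus (P k) 1}.Finite

/-! ### The three families -/

/-- `A` is `1` or a product of cyclotomic polynomials (with repetitions allowed). -/
def IsCyclotomicProduct (A : ℂ[X]) : Prop :=
  ∃ s : Multiset ℕ, (∀ n ∈ s, 0 < n) ∧ A = (s.map fun n => cyclotomic n ℂ).prod

/-- The polynomial `A(x) y² + M(x) y + x ^ d A(1 / x)`, where `deg A ≤ d`. -/
def quadraticInY (d : ℕ) (A M : ℂ[X]) : ℂ[X][Y] :=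
  C A * Y ^ 2 + C M * Y + C (A.reflect d)

/-- First type (`d = 5`). -/
def type1 (A B : ℂ[X]) (k l : ℂ) : ℂ[X][Y] :=
  quadraticInY 5 A (B + C k * (X ^ 4 + X) + C l * (X ^ 3 + X ^ 2))

/-- Second type (`d = 6`). -/
def type2 (A B : ℂ[X]) (k l m : ℂ) : ℂ[X][Y] :=
  quadraticInY 6 A (B + C k * (X ^ 5 + X) + C l * (X ^ 4 + X ^ 2) + C m * X ^ 3)

/-- Third type (`d = 8`). -/
def type3 (A B : ℂ[X]) (a k l m : ℂ) : ℂ[X][Y] :=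
  quadraticInY 8 A
    (B + C (2 * a) * (X ^ 7 + X) + C k * (X ^ 6 + X ^ 2) + C l * (X ^ 5 + X ^ 3) + C m * X ^ 4)

end Genus3

end

noncomputable section

namespace Genus3

/-! Every `P_k` is quadratic in `y`, with outer coefficients `A` and `C_d = x^e A`, where `e = d -
deg A`. The substitution `t = x + 1/x` turns the palindromic data into polynomials in `t`: `A = x^n
a(t)`, and the middle coefficient `M` is, up to a monomial (and a factor `x + 1` when `d = 5`), a
polynomial `k p(t) + N(t)`. The prescribed values of `l` and `m` say exactly that the discriminant
`M² - 4 x^e A²` vanishes at `x = 1` (and at `x = -1` when `d` is even). There it has double zeros,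
which split off as a square: `M² - 4 x^e A² = S² x⁴ q_k(t)`, where `q_k = k² (t² - 4) + 2k N + R`
(for `d = 5`, with `(t + 2) N` in place of `N`).

Suppose `q_k` is squarefree of degree 3 or 4 and `q_k(±2) ≠ 0`. Then `x⁴ q_k(x + 1/x)` is squarefree
of degree 7 or 8, so `P_k` is irreducible and its curve is birational to `v² = x⁴ q_k(x + 1/x)`, of
genus 3. The involution acts by `x ↦ 1/x`, `v ↦ v/x⁴`, and its fixed field is generated by `t` and
`u = v/x²` with `u² = q_k(t)`, of genus 1 (`isHyperelliptic_fixedField`).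

That `q_k` is good for almost all `k` follows because, after a substitution and multiplication by a
fixed polynomial, it factors into two polynomials linear in `k`. A multiple root of `k p + r` makes
`k` a critical value of `-r/p`, and a common root of both factors lies in a fixed finite set
(`finite_double_root_mul`).

The genus is a count of differentials regular at all valuation rings, so it is computed directly in
`IsHyperelliptic.genus_eq`: for `v² = f(x)` with `deg f` equal to `2g + 1` or `2g + 2`, they are the
`S(x) dx/v` with `deg S < g`.

Temperedness is read off the Newton polygon, which has only three rows: horizontal sides carry `A`,
all others carry `1 + t` or `1 + b t + t²` with `b ∈ {0, 1, 2}`. -/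

/-! ### Laurent series: derivation and square roots -/

/-- The formal derivative extends to the field of Laurent series. -/
theorem exists_laurent_derivation :
    ∃ D : Derivation ℂ (FractionRing (PowerSeries ℂ)) (FractionRing (PowerSeries ℂ)),
      ∀ g : PowerSeries ℂ, D (algebraMap _ _ g) = algebraMap _ _ (PowerSeries.derivative ℂ g) := by
  set K := FractionRing (PowerSeries ℂ)
  let M := nonZeroDivisors (PowerSeries ℂ)
  let D₀ : Derivation ℂ (PowerSeries ℂ) K :=
    (Algebra.linearMap (PowerSeries ℂ) K).compDer (PowerSeries.derivative ℂ)
  let L₀ := D₀.liftKaehlerDifferential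
  have hunit : ∀ m : M, IsUnit (algebraMap (PowerSeries ℂ)
      (Module.End (PowerSeries ℂ) K) m) := fun m =>
    IsLocalizedModule.map_units (Algebra.linearMap (PowerSeries ℂ) K) m
  -- Kähler differentials commute with localization, so the derivation extends uniquely to the
  -- fraction field.
  let L₁ := IsLocalizedModule.lift M (KaehlerDifferential.map ℂ ℂ (PowerSeries ℂ) K) L₀ hunit
  let L₂ : Ω[K⁄ℂ] →ₗ[K] K := L₁.extendScalarsOfIsLocalization M K
  refine ⟨L₂.compDer (KaehlerDifferential.D ℂ K), fun g => ?_⟩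
  have h1 : KaehlerDifferential.D ℂ K (algebraMap _ _ g) =
      KaehlerDifferential.map ℂ ℂ (PowerSeries ℂ) K (KaehlerDifferential.D ℂ _ g) := by simp
  have h2 : L₁ (KaehlerDifferential.map ℂ ℂ (PowerSeries ℂ) K (KaehlerDifferential.D ℂ _ g)) =
      L₀ (KaehlerDifferential.D ℂ _ g) := IsLocalizedModule.lift_apply M _ L₀ hunit _
  change L₁ (KaehlerDifferential.D ℂ K (algebraMap _ _ g)) = _
  rw [h1, h2]
  simp [L₀, D₀]
  rfl

theorem exists_sq_eq_one_add_X :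
    ∃ V : PowerSeries ℂ, V ^ 2 = 1 + PowerSeries.X := by
  refine ⟨PowerSeries.binomialSeries ℂ (1 / 2 : ℚ), ?_⟩
  rw [sq, ← PowerSeries.binomialSeries_add]
  have := PowerSeries.binomialSeries_nat (R := ℚ) (A := ℂ) 1
  norm_num at this ⊢
  exact this

theorem exists_sq_eq_add_X_sq (a : ℂ) :
    ∃ V : PowerSeries ℂ, V ^ 2 = PowerSeries.C a + PowerSeries.X ^ 2 := by
  by_cases ha : a = 0
  · exact ⟨PowerSeries.X, by simp [ha]⟩
  obtain ⟨V, hV⟩ := exists_sq_eq_one_add_X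
  obtain ⟨b, hb⟩ := IsAlgClosed.exists_pow_nat_eq a (n := 2) (by norm_num)
  have hs : PowerSeries.HasSubst (PowerSeries.C a⁻¹ * PowerSeries.X ^ 2 : PowerSeries ℂ) :=
    PowerSeries.HasSubst.of_constantCoeff_zero' (by simp)
  refine ⟨PowerSeries.C b * PowerSeries.substAlgHom hs V, ?_⟩
  rw [mul_pow, ← map_pow, ← map_pow, hV, hb, map_add, map_one, PowerSeries.substAlgHom_X, mul_add,
    ← mul_assoc, ← map_mul, mul_inv_cancel₀ ha]
  simp

/-- Each linear factor of `f` becomes `(c - a) + X²`. Using `X²` instead of `X` as the increment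
gives a root even to a factor vanishing at `c`, so branch points need no separate treatment. -/
theorem exists_sq_eq_aeval (f : ℂ[X]) (c : ℂ) :
    ∃ V : PowerSeries ℂ, V ^ 2 = aeval (PowerSeries.C c + PowerSeries.X ^ 2) f := by
  have key : ∀ s : Multiset ℂ, ∃ V : PowerSeries ℂ,
      V ^ 2 = aeval (PowerSeries.C c + PowerSeries.X ^ 2) (s.map fun a => X - C a).prod := by
    intro s
    induction s using Multiset.induction_on with
    | empty => exact ⟨1, by simp⟩
    | cons a s ih =>
      obtain ⟨V, hV⟩ := ih
      obtain ⟨W, hW⟩ := exists_sq_eq_add_X_sq (c - a)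
      refine ⟨W * V, ?_⟩
      rw [mul_pow, hV, hW, Multiset.map_cons, Multiset.prod_cons, map_mul]
      congr 1
      simp
      ring
  obtain ⟨V, hV⟩ := key f.roots
  obtain ⟨b, hb⟩ := IsAlgClosed.exists_pow_nat_eq f.leadingCoeff (n := 2) (by norm_num)
  refine ⟨PowerSeries.C b * V, ?_⟩
  conv_rhs => rw [(IsAlgClosed.splits f).eq_prod_roots]
  rw [mul_pow, hV, map_mul, aeval_C, ← map_pow, hb]
  rfl

/-! ### Hyperelliptic function fields -/

/-- `F = ℂ(x, v)` with `x` transcendental and `v ^ 2 = f(x)`, where `f` is squarefree. -/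
structure IsHyperelliptic {F : Type} [Field F] [Algebra ℂ F] (x v : F) (f : ℂ[X]) : Prop where
  transcendental : Transcendental ℂ x
  sq : v ^ 2 = aeval x f
  squarefree : Squarefree f
  natDegree_pos : 0 < f.natDegree
  adjoin_eq_top : IntermediateField.adjoin ℂ {x, v} = ⊤

/-- A squarefree polynomial of positive degree is not a square in `ℂ(x)`. -/
theorem eq_zero_of_sq_eq_mul_sq {f a b : ℂ[X]} (hf : Squarefree f) (hd : 0 < f.natDegree)
    (h : a ^ 2 = f * b ^ 2) : b = 0 := by
  by_contra hb
  have h1 : b ∣ a := by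
    rw [← IsIntegrallyClosed.pow_dvd_pow_iff two_ne_zero, h]
    exact dvd_mul_left _ _
  obtain ⟨c, rfl⟩ := h1
  have h2 : c * c = f := by
    have : b ^ 2 ≠ 0 := pow_ne_zero _ hb
    apply mul_right_cancel₀ this
    rw [← h]; ring
  have h3 := hf c ⟨1, by rw [h2, mul_one]⟩
  have h4 := natDegree_eq_zero_of_isUnit (h3.mul h3)
  rw [h2] at h4
  omega

theorem eq_zero_of_add_mul_eq_zero {L : Type*} [Field L] [Algebra ℂ L] {x v : L} {f : ℂ[X]}
    (hx : Transcendental ℂ x) (hv : v ^ 2 = aeval x f) (hf : Squarefree f)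
    (hd : 0 < f.natDegree) {a b : ℂ[X]} (h : aeval x a + aeval x b * v = 0) : a = 0 ∧ b = 0 := by
  have hinj := transcendental_iff_injective.1 hx
  have h1 : a ^ 2 = f * b ^ 2 := by
    apply hinj
    simp only [map_mul, map_pow]
    rw [← hv]
    linear_combination (aeval x a - aeval x b * v) * h
  have hb := eq_zero_of_sq_eq_mul_sq hf hd h1
  refine ⟨?_, hb⟩
  rw [hb] at h1
  simpa using h1

namespace IsHyperelliptic

variable {F : Type} [Field F] [Algebra ℂ F] {x v : F} {f : ℂ[X]}

theorem aeval_ne_zero (h : IsHyperelliptic x v f) {d : ℂ[X]} (hd : d ≠ 0) : aeval x d ≠ 0 :=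
  fun h0 => hd ((transcendental_iff_injective.1 h.transcendental) (by simpa using h0))

theorem x_ne_zero (h : IsHyperelliptic x v f) : x ≠ 0 := by
  simpa using h.aeval_ne_zero X_ne_zero

theorem v_ne_zero (h : IsHyperelliptic x v f) : v ≠ 0 := by
  have := h.aeval_ne_zero h.squarefree.ne_zero
  rw [← h.sq] at this
  exact fun h0 => this (by simp [h0])

theorem exists_rep (h : IsHyperelliptic x v f) (z : F) :
    ∃ a b d : ℂ[X], d ≠ 0 ∧ z = (aeval x a + aeval x b * v) / aeval x d := by
  have hz : z ∈ IntermediateField.adjoin ℂ {x, v} := h.adjoin_eq_top ▸ IntermediateField.mem_top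
  induction hz using IntermediateField.adjoin_induction with
  | mem y hy =>
    rcases hy with rfl | rfl
    · exact ⟨X, 0, 1, one_ne_zero, by simp⟩
    · exact ⟨0, 1, 1, one_ne_zero, by simp⟩
  | algebraMap c => exact ⟨C c, 0, 1, one_ne_zero, by simp⟩
  | add y z _ _ hy hz =>
    obtain ⟨a, b, d, hd, rfl⟩ := hy
    obtain ⟨a', b', d', hd', rfl⟩ := hz
    have := h.aeval_ne_zero hd
    have := h.aeval_ne_zero hd'
    refine ⟨a * d' + a' * d, b * d' + b' * d, d * d', mul_ne_zero hd hd', ?_⟩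
    simp only [map_add, map_mul]
    field_simp
    ring
  | mul y z _ _ hy hz =>
    obtain ⟨a, b, d, hd, rfl⟩ := hy
    obtain ⟨a', b', d', hd', rfl⟩ := hz
    have := h.aeval_ne_zero hd
    have := h.aeval_ne_zero hd'
    refine ⟨a * a' + b * b' * f, a * b' + a' * b, d * d', mul_ne_zero hd hd', ?_⟩
    simp only [map_add, map_mul, ← h.sq]
    field_simp
    ring
  | inv y _ hy =>
    obtain ⟨a, b, d, hd, rfl⟩ := hy
    have hd0 := h.aeval_ne_zero hd
    by_cases hab : aeval x a + aeval x b * v = 0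
    · exact ⟨0, 0, 1, one_ne_zero, by simp [hab]⟩
    have hn : a ^ 2 - f * b ^ 2 ≠ 0 := by
      intro h0
      have hb := eq_zero_of_sq_eq_mul_sq h.squarefree h.natDegree_pos (sub_eq_zero.1 h0)
      have ha : a = 0 := by simpa [hb] using h0
      exact hab (by simp [ha, hb])
    have hn0 := h.aeval_ne_zero hn
    -- Rationalize the denominator by the conjugate `a - b v`; its norm is nonzero because `f` is
    -- not a square.
    refine ⟨d * a, -(d * b), a ^ 2 - f * b ^ 2, hn, ?_⟩
    rw [inv_div, div_eq_div_iff hab hn0]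
    simp only [map_sub, map_mul, map_pow, map_neg, ← h.sq]
    ring

/-- The universal property of `ℂ(x, v)`. -/
theorem exists_lift (h : IsHyperelliptic x v f) {L : Type} [Field L] [Algebra ℂ L] {x' v' : L}
    (hx : Transcendental ℂ x') (hv : v' ^ 2 = aeval x' f) :
    ∃ φ : F →ₐ[ℂ] L, φ x = x' ∧ φ v = v' := by
  -- Both fields receive the domain `ℂ[x, v]/(v² - f)` injectively, and `F` is its fraction field.
  let P : ℂ[X][X] := X ^ 2 - C f
  have hP : P.Monic := monic_X_pow_sub_C f (by norm_num)
  have hPd : P.natDegree = 2 := natDegree_X_pow_sub_C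
  have lift : ∀ {L : Type} [Field L] [Algebra ℂ L] {x' v' : L}, Transcendental ℂ x' →
      v' ^ 2 = aeval x' f → ∃ φ : AdjoinRoot P →+* L,
        (∀ p : ℂ[X], φ (AdjoinRoot.of P p) = aeval x' p) ∧
        φ (AdjoinRoot.root P) = v' ∧ Function.Injective φ := by
    intro L _ _ x' v' hx hv
    have hev : P.eval₂ (aeval x' : ℂ[X] →ₐ[ℂ] L).toRingHom v' = 0 := by simp [P, hv]
    refine ⟨AdjoinRoot.lift (aeval x' : ℂ[X] →ₐ[ℂ] L).toRingHom v' hev,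
      fun p => AdjoinRoot.lift_of hev, AdjoinRoot.lift_root hev, ?_⟩
    rw [injective_iff_map_eq_zero]
    intro r hr
    obtain ⟨p, rfl⟩ := AdjoinRoot.mk_surjective r
    have hmod : AdjoinRoot.mk P p = AdjoinRoot.mk P (p %ₘ P) := by
      conv_lhs => rw [← modByMonic_add_div p P]
      simp
    have hdeg : (p %ₘ P).natDegree ≤ 1 := by
      have := natDegree_modByMonic_lt p hP (by intro h1; simp [h1] at hPd)
      omega
    rw [hmod] at hr ⊢
    rw [eq_X_add_C_of_natDegree_le_one hdeg] at hr ⊢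
    have h0 : aeval x' ((p %ₘ P).coeff 0) + aeval x' ((p %ₘ P).coeff 1) * v' = 0 := by
      rw [← hr, AdjoinRoot.lift_mk]
      simp [add_comm]
    obtain ⟨h1, h2⟩ := eq_zero_of_add_mul_eq_zero hx hv h.squarefree h.natDegree_pos h0
    simp [h1, h2]
  obtain ⟨φ, hφ, hφv, hφi⟩ := lift h.transcendental h.sq
  obtain ⟨ψ, hψ, hψv, hψi⟩ := lift hx hv
  let : Algebra (AdjoinRoot P) F := φ.toAlgebra
  let : Algebra (AdjoinRoot P) L := ψ.toAlgebra
  have : FaithfulSMul (AdjoinRoot P) F := (faithfulSMul_iff_algebraMap_injective _ _).2 hφi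
  have : IsFractionRing (AdjoinRoot P) F := by
    apply IsFractionRing.of_field
    intro z
    obtain ⟨a, b, d, hd, rfl⟩ := h.exists_rep z
    refine ⟨AdjoinRoot.of P a + AdjoinRoot.of P b * AdjoinRoot.root P, AdjoinRoot.of P d, ?_⟩
    change _ = φ _ / φ _
    simp [hφ, hφv]
  let Φ : F →+* L := IsFractionRing.lift (A := AdjoinRoot P) (K := F) (g := ψ) hψi
  have hΦ : ∀ r, Φ (φ r) = ψ r := fun r => IsFractionRing.lift_algebraMap hψi r
  refine ⟨⟨Φ, fun c => ?_⟩, ?_, ?_⟩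
  · have := hΦ (AdjoinRoot.of P (C c))
    rw [hφ, hψ] at this
    simpa using this
  · have := hΦ (AdjoinRoot.of P X)
    rw [hφ, hψ] at this
    simpa using this
  · have := hΦ (AdjoinRoot.root P)
    rw [hφv, hψv] at this
    simpa using this

theorem algHom_ext (h : IsHyperelliptic x v f) {L : Type} [Field L] [Algebra ℂ L]
    {φ ψ : F →ₐ[ℂ] L} (hx : φ x = ψ x) (hv : φ v = ψ v) : φ = ψ := by
  ext z
  obtain ⟨a, b, d, hd, rfl⟩ := h.exists_rep z
  simp [← aeval_algHom_apply, hx, hv]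

theorem D_v (h : IsHyperelliptic x v f) : KaehlerDifferential.D ℂ F v =
    (aeval x (derivative f) / (2 * v)) • KaehlerDifferential.D ℂ F x := by
  have hv := h.v_ne_zero
  have h1 := congrArg (KaehlerDifferential.D ℂ F) h.sq
  rw [Derivation.map_aeval, pow_two, Derivation.leibniz, ← add_smul] at h1
  have : (2 : F) ≠ 0 := by
    have := charZero_of_injective_algebraMap (FaithfulSMul.algebraMap_injective ℂ F)
    exact two_ne_zero
  rw [div_eq_inv_mul, mul_smul, ← h1, smul_smul, ← two_mul, inv_mul_cancel₀ (mul_ne_zero this hv),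
    one_smul]

theorem exists_smul_D (h : IsHyperelliptic x v f) (ω : Ω[F⁄ℂ]) :
    ∃ ρ : F, ω = ρ • KaehlerDifferential.D ℂ F x := by
  have key : ∀ z : F, KaehlerDifferential.D ℂ F z ∈ Submodule.span F {KaehlerDifferential.D ℂ F x} := by
    intro z
    have hz : z ∈ IntermediateField.adjoin ℂ {x, v} := h.adjoin_eq_top ▸ IntermediateField.mem_top
    induction hz using IntermediateField.adjoin_induction with
    | mem y hy =>
      rcases hy with rfl | rfl
      · exact Submodule.mem_span_singleton_self _
      · rw [h.D_v]
        exact Submodule.smul_mem _ _ (Submodule.mem_span_singleton_self _)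
    | algebraMap c => simp
    | add y z _ _ hy hz => rw [map_add]; exact add_mem hy hz
    | mul y z _ _ hy hz =>
      rw [Derivation.leibniz]
      exact add_mem (Submodule.smul_mem _ _ hz) (Submodule.smul_mem _ _ hy)
    | inv y _ hy =>
      rw [Derivation.leibniz_inv]
      exact Submodule.smul_mem _ _ hy
  have htop : ω ∈ Submodule.span F (Set.range (KaehlerDifferential.D ℂ F)) := by
    rw [KaehlerDifferential.span_range_derivation]; trivial
  have hle : Submodule.span F (Set.range (KaehlerDifferential.D ℂ F)) ≤
      Submodule.span F {KaehlerDifferential.D ℂ F x} := by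
    rw [Submodule.span_le]
    rintro _ ⟨z, rfl⟩
    exact key z
  obtain ⟨ρ, hρ⟩ := Submodule.mem_span_singleton.1 (hle htop)
  exact ⟨ρ, hρ.symm⟩

end IsHyperelliptic

/-! ### Finite places: polynomial form of regular differentials -/

theorem aeval_eq_eval_add_X_sq_mul (p : ℂ[X]) (c : ℂ) : ∃ r : PowerSeries ℂ,
    aeval (PowerSeries.C c + PowerSeries.X ^ 2 : PowerSeries ℂ) p =
      PowerSeries.C (p.eval c) + PowerSeries.X ^ 2 * r := by
  have h : X - C c ∣ p - C (p.eval c) := by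
    rw [dvd_iff_isRoot]; simp
  obtain ⟨q, hq⟩ := h
  refine ⟨aeval (PowerSeries.C c + PowerSeries.X ^ 2 : PowerSeries ℂ) q, ?_⟩
  have := congrArg (aeval (PowerSeries.C c + PowerSeries.X ^ 2 : PowerSeries ℂ)) hq
  rw [map_sub, map_mul, sub_eq_iff_eq_add'] at this
  rw [this]
  simp [PowerSeries.C_eq_algebraMap]

theorem transcendental_add_X_sq (c : ℂ) :
    Transcendental ℂ (PowerSeries.C c + PowerSeries.X ^ 2 : PowerSeries ℂ) := by
  rw [transcendental_iff]
  intro p hp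
  by_contra h0
  obtain ⟨q, hq, hqr⟩ := exists_eq_pow_rootMultiplicity_mul_and_not_dvd p h0 c
  rw [hq, map_mul, map_pow, mul_eq_zero] at hp
  rcases hp with hp | hp
  · have h1 := eq_zero_of_pow_eq_zero hp
    have h2 : (PowerSeries.X ^ 2 : PowerSeries ℂ) = 0 := by
      rw [← h1]; simp [PowerSeries.C_eq_algebraMap]
    exact pow_ne_zero 2 PowerSeries.X_ne_zero h2
  · obtain ⟨r, hr⟩ := aeval_eq_eval_add_X_sq_mul q c
    rw [hp] at hr
    apply hqr
    rw [dvd_iff_isRoot, IsRoot.def]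
    simpa using (congrArg PowerSeries.constantCoeff hr).symm

/-- A parity argument: a rational function evaluated at `c + X²` has even order in `X`, so order at
least `-1` already means order at least `0`, and `p/d` has no pole at any `c`. -/
theorem dvd_of_forall_X_mul_aeval_eq {p d : ℂ[X]} (hd : d ≠ 0)
    (h : ∀ c : ℂ, ∃ r : PowerSeries ℂ,
      PowerSeries.X * aeval (PowerSeries.C c + PowerSeries.X ^ 2 : PowerSeries ℂ) p =
        aeval (PowerSeries.C c + PowerSeries.X ^ 2 : PowerSeries ℂ) d * r) : d ∣ p := by
  obtain ⟨p', d', hp, hd', hu⟩ := extract_gcd p d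
  set g := gcd p d
  have hg : g ≠ 0 := by rintro h0; rw [h0, zero_mul] at hd'; exact hd hd'
  suffices IsUnit d' by
    rw [hd', hp]; exact mul_dvd_mul_left _ this.dvd
  by_contra hdu
  have hdeg : d'.degree ≠ 0 := fun h0 => hdu (isUnit_iff_degree_eq_zero.2 h0)
  obtain ⟨c, hc⟩ := IsAlgClosed.exists_root d' hdeg
  have hpc : p'.eval c ≠ 0 := by
    intro h0
    have h1 : X - C c ∣ gcd p' d' := dvd_gcd (dvd_iff_isRoot.2 h0) (dvd_iff_isRoot.2 hc)
    exact not_isUnit_X_sub_C c (isUnit_of_dvd_unit h1 hu)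
  obtain ⟨r, hr⟩ := h c
  have hgc : aeval (PowerSeries.C c + PowerSeries.X ^ 2 : PowerSeries ℂ) g ≠ 0 := fun h0 =>
    hg (transcendental_iff.1 (transcendental_add_X_sq c) g h0)
  obtain ⟨a, ha⟩ := aeval_eq_eval_add_X_sq_mul p' c
  obtain ⟨b, hb⟩ := aeval_eq_eval_add_X_sq_mul d' c
  rw [hp, hd', map_mul, map_mul, ha, hb, hc.eq_zero] at hr
  have h2 : PowerSeries.C (p'.eval c) = PowerSeries.X * (b * r - PowerSeries.X * a) := by
    apply mul_left_cancel₀ (mul_ne_zero hgc PowerSeries.X_ne_zero)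
    rw [map_zero] at hr
    linear_combination hr
  apply hpc
  simpa using congrArg PowerSeries.constantCoeff h2

theorem derivative_C_add_X_sq (c : ℂ) :
    PowerSeries.derivative ℂ (PowerSeries.C c + PowerSeries.X ^ 2) =
      PowerSeries.C 2 * PowerSeries.X := by
  rw [map_add, pow_two, Derivation.leibniz]
  rw [map_ofNat (PowerSeries.C (R := ℂ)) 2]
  simp [PowerSeries.derivative_C]
  ring

theorem laurent_ne_zero {d : ℂ[X]} (hd : d ≠ 0) (c : ℂ) :
    aeval (PowerSeries.C c + PowerSeries.X ^ 2 : PowerSeries ℂ) d ≠ 0 := fun h0 =>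
  hd (transcendental_iff.1 (transcendental_add_X_sq c) d h0)

/-- A regular differential has no pole at the place given by an embedding in the field of
Laurent series. -/
theorem exists_of_mem_regularDifferentials {F : Type} [Field F] [Algebra ℂ F]
    (D : Derivation ℂ (FractionRing (PowerSeries ℂ)) (FractionRing (PowerSeries ℂ)))
    (hD : ∀ g : PowerSeries ℂ, D (algebraMap _ _ g) = algebraMap _ _ (PowerSeries.derivative ℂ g))
    (φ : F →ₐ[ℂ] FractionRing (PowerSeries ℂ)) {ρ x : F}
    (h : ρ • KaehlerDifferential.D ℂ F x ∈ regularDifferentials ℂ F) :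
    ∃ r : PowerSeries ℂ, φ ρ * D (φ x) = algebraMap _ _ r := by
  let K := FractionRing (PowerSeries ℂ)
  -- The place is the pullback of the power series ring; there `a db` becomes a power series times
  -- the derivative of a power series.
  let O : ValuationSubring F := (ValuationRing.valuation (PowerSeries ℂ) K).valuationSubring.comap
    φ.toRingHom
  have hO : ∀ z : F, z ∈ O ↔ ∃ r : PowerSeries ℂ, algebraMap _ K r = φ z := fun z =>
    ValuationRing.mem_integer_iff _ K (φ z)
  let _ : Algebra F K := φ.toRingHom.toAlgebra
  have : IsScalarTower ℂ F K := IsScalarTower.of_algebraMap_eq fun c => (φ.commutes c).symm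
  let L : Ω[F⁄ℂ] →ₗ[F] K := (D.compAlgebraMap F).liftKaehlerDifferential
  have hL : ∀ a b : F, L (a • KaehlerDifferential.D ℂ F b) = φ a * D (φ b) := by
    intro a b
    rw [map_smul, Derivation.liftKaehlerDifferential_comp_D]
    rfl
  have h1 := (Submodule.mem_iInf _).1 ((Submodule.mem_iInf _).1 h O)
    (fun c => (hO _).2 ⟨PowerSeries.C c, by
      rw [AlgHom.commutes, PowerSeries.C_eq_algebraMap, ← IsScalarTower.algebraMap_apply]⟩)
  have h2 : ∀ ω ∈ Submodule.span ℂ {ω | ∃ a ∈ O, ∃ b ∈ O, ω = a • KaehlerDifferential.D ℂ F b},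
      ∃ r : PowerSeries ℂ, L ω = algebraMap _ _ r := by
    intro ω hω
    induction hω using Submodule.span_induction with
    | mem ω hω =>
      obtain ⟨a, ha, b, hb, rfl⟩ := hω
      obtain ⟨r, hr⟩ := (hO a).1 ha
      obtain ⟨s, hs⟩ := (hO b).1 hb
      exact ⟨r * PowerSeries.derivative ℂ s, by rw [hL, ← hr, ← hs, hD, map_mul]⟩
    | zero => exact ⟨0, by simp⟩
    | add y z _ _ hy hz =>
      obtain ⟨r, hr⟩ := hy
      obtain ⟨s, hs⟩ := hz
      exact ⟨r + s, by rw [map_add, hr, hs, map_add]⟩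
    | smul c y _ hy =>
      obtain ⟨r, hr⟩ := hy
      refine ⟨c • r, ?_⟩
      rw [LinearMap.map_smul_of_tower, hr]
      exact (map_smul (IsScalarTower.toAlgHom ℂ (PowerSeries ℂ) K) c r).symm
  obtain ⟨r, hr⟩ := h2 _ h1
  exact ⟨r, by rw [← hr, hL]⟩

namespace IsHyperelliptic

variable {F : Type} [Field F] [Algebra ℂ F] {x v : F} {f : ℂ[X]}

theorem exists_embedding (h : IsHyperelliptic x v f) {c : ℂ} {V : PowerSeries ℂ}
    (hV : V ^ 2 = aeval (PowerSeries.C c + PowerSeries.X ^ 2) f) :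
    ∃ φ : F →ₐ[ℂ] FractionRing (PowerSeries ℂ),
      φ x = algebraMap _ _ (PowerSeries.C c + PowerSeries.X ^ 2) ∧ φ v = algebraMap _ _ V := by
  apply h.exists_lift
  · rw [transcendental_algebraMap_iff (FaithfulSMul.algebraMap_injective _ _)]
    exact transcendental_add_X_sq c
  · rw [aeval_algebraMap_apply, ← hV, map_pow]

theorem D_x_ne_zero (h : IsHyperelliptic x v f) : KaehlerDifferential.D ℂ F x ≠ 0 := by
  intro h0
  obtain ⟨D, hD⟩ := exists_laurent_derivation
  obtain ⟨V, hV⟩ := exists_sq_eq_aeval f 0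
  obtain ⟨φ, hφ, -⟩ := h.exists_embedding hV
  have hreg : ∀ ρ : F, ∃ r : PowerSeries ℂ, φ ρ * D (φ x) = algebraMap _ _ r := fun ρ =>
    exists_of_mem_regularDifferentials D hD φ (by rw [h0, smul_zero]; exact zero_mem _)
  -- If `dx` were `0`, then `dx/x` would be regular, although it pulls back to `2X/X²` under `x =
  -- X²`.
  obtain ⟨r, hr⟩ := hreg (x⁻¹)
  rw [hφ, hD, map_inv₀, hφ] at hr
  have hne := laurent_ne_zero X_ne_zero (0 : ℂ)
  rw [aeval_X] at hne
  have hne' : algebraMap (PowerSeries ℂ) (FractionRing (PowerSeries ℂ))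
      (PowerSeries.C 0 + PowerSeries.X ^ 2) ≠ 0 := by
    simp
  rw [inv_mul_eq_iff_eq_mul₀ hne', ← map_mul] at hr
  have h2 := FaithfulSMul.algebraMap_injective _ _ hr
  rw [derivative_C_add_X_sq, map_zero, zero_add, pow_two, mul_assoc, mul_comm] at h2
  have h3 := mul_left_cancel₀ PowerSeries.X_ne_zero h2
  simpa using congrArg PowerSeries.constantCoeff h3

/-- Write the differential as `(a + b v)/d dx`. Regularity along `x = c + X²`, where `dx`
contributes `2X`, for both signs of the root `V`, separates the conditions on `a` and on `b`: `d`
divides `a` and `b f`. -/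
theorem exists_polynomial_rep (h : IsHyperelliptic x v f) {ω : Ω[F⁄ℂ]}
    (hω : ω ∈ regularDifferentials ℂ F) : ∃ R S : ℂ[X],
      ω = (aeval x R + aeval x S / v) • KaehlerDifferential.D ℂ F x := by
  obtain ⟨D, hD⟩ := exists_laurent_derivation
  obtain ⟨ρ, rfl⟩ := h.exists_smul_D ω
  obtain ⟨a, b, d, hd, rfl⟩ := h.exists_rep ρ
  let K := FractionRing (PowerSeries ℂ)
  have hinj : Function.Injective (algebraMap (PowerSeries ℂ) K) :=
    FaithfulSMul.algebraMap_injective _ _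
  have key : ∀ (c : ℂ) (V : PowerSeries ℂ),
      V ^ 2 = aeval (PowerSeries.C c + PowerSeries.X ^ 2) f → ∃ r : PowerSeries ℂ,
      (aeval (PowerSeries.C c + PowerSeries.X ^ 2) a +
        aeval (PowerSeries.C c + PowerSeries.X ^ 2) b * V) * (PowerSeries.C 2 * PowerSeries.X) =
        aeval (PowerSeries.C c + PowerSeries.X ^ 2) d * r := by
    intro c V hV
    obtain ⟨φ, hx, hv⟩ := h.exists_embedding hV
    obtain ⟨r, hr⟩ := exists_of_mem_regularDifferentials D hD φ hω
    refine ⟨r, hinj ?_⟩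
    have hne : algebraMap (PowerSeries ℂ) K (aeval (PowerSeries.C c + PowerSeries.X ^ 2) d) ≠ 0 := by
      simpa using laurent_ne_zero hd c
    rw [hx, hD, derivative_C_add_X_sq, map_div₀, map_add, map_mul, hv, ← aeval_algHom_apply, ← aeval_algHom_apply,
      ← aeval_algHom_apply, hx, aeval_algebraMap_apply, aeval_algebraMap_apply,
      aeval_algebraMap_apply, div_mul_eq_mul_div, div_eq_iff hne] at hr
    simp only [map_mul, map_add]
    simp only [map_mul] at hr
    rw [hr, mul_comm]
  have hC2 : (PowerSeries.C (2 : ℂ)) ≠ 0 := by simp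
  have h4 : PowerSeries.C (4⁻¹ : ℂ) * PowerSeries.C 4 = 1 := by
    rw [← map_mul]; norm_num
  have h22 : PowerSeries.C (2 : ℂ) * PowerSeries.C 2 = PowerSeries.C 4 := by
    rw [← map_mul]; norm_num
  have h2' : PowerSeries.C (2 : ℂ) + PowerSeries.C 2 = PowerSeries.C 4 := by
    rw [← map_add]; norm_num
  have hda : d ∣ a := by
    apply dvd_of_forall_X_mul_aeval_eq hd
    intro c
    obtain ⟨V, hV⟩ := exists_sq_eq_aeval f c
    obtain ⟨r, hr⟩ := key c V hV
    obtain ⟨s, hs⟩ := key c (-V) (by rw [neg_sq, hV])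
    refine ⟨PowerSeries.C 4⁻¹ * (r + s), ?_⟩
    linear_combination PowerSeries.C (4⁻¹ : ℂ) * (hr + hs) -
      PowerSeries.X * aeval (PowerSeries.C c + PowerSeries.X ^ 2) a * (h4 +
      PowerSeries.C (4⁻¹ : ℂ) * h2')
  have hdb : d ∣ b * f := by
    apply dvd_of_forall_X_mul_aeval_eq hd
    intro c
    obtain ⟨V, hV⟩ := exists_sq_eq_aeval f c
    obtain ⟨r, hr⟩ := key c V hV
    obtain ⟨s, hs⟩ := key c (-V) (by rw [neg_sq, hV])
    -- The difference isolates `b V`; one more factor `V` turns it into the polynomial `b f`, to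
    -- which the parity argument applies.
    refine ⟨PowerSeries.C 4⁻¹ * V * (r - s), ?_⟩
    rw [map_mul, ← hV]
    linear_combination PowerSeries.C (4⁻¹ : ℂ) * V * (hr - hs) -
      PowerSeries.X * aeval (PowerSeries.C c + PowerSeries.X ^ 2) b * V ^ 2 * (h4 +
      PowerSeries.C (4⁻¹ : ℂ) * h2')
  obtain ⟨R, rfl⟩ := hda
  obtain ⟨S, hS⟩ := hdb
  refine ⟨R, S, ?_⟩
  congr 1
  have hd0 := h.aeval_ne_zero hd
  have hv0 := h.v_ne_zero
  have hS' := congrArg (aeval x) hS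
  simp only [map_mul, ← h.sq] at hS'
  rw [map_mul]
  field_simp
  linear_combination hS'

end IsHyperelliptic

/-! ### The chart at infinity and the genus -/

theorem aeval_reflect {F : Type*} [Field F] [Algebra ℂ F] {x : F} (hx : x ≠ 0) {N : ℕ}
    {p : ℂ[X]} (hp : p.natDegree ≤ N) : aeval x (p.reflect N) = x ^ N * aeval x⁻¹ p := by
  let := invertibleOfNonzero (inv_ne_zero hx)
  have h := eval₂_reflect_mul_pow (algebraMap ℂ F) x⁻¹ N p hp
  rw [invOf_eq_inv, inv_inv] at h
  rw [aeval_def, aeval_def, ← h, inv_pow]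
  field_simp

theorem squarefree_of_forall_not_sq_dvd {f : ℂ[X]}
    (h : ∀ c : ℂ, ¬ (X - C c) ^ 2 ∣ f) : Squarefree f := by
  intro p hp
  by_contra hu
  obtain ⟨c, hc⟩ := IsAlgClosed.exists_root p (fun h0 => hu (isUnit_iff_degree_eq_zero.2 h0))
  refine h c (dvd_trans ?_ hp)
  rw [sq]
  exact mul_dvd_mul (dvd_iff_isRoot.2 hc) (dvd_iff_isRoot.2 hc)

theorem natDegree_reflect_le' {p : ℂ[X]} {N : ℕ} (hp : p.natDegree ≤ N) :
    (p.reflect N).natDegree ≤ N := by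
  rw [natDegree_le_iff_coeff_eq_zero]
  intro i hi
  rw [coeff_reflect, revAt_eq_self_of_lt hi]
  exact coeff_eq_zero_of_natDegree_lt (by omega)

theorem reflect_reflect (p : ℂ[X]) (N : ℕ) : (p.reflect N).reflect N = p := by
  ext i; simp

/-- Nonzero roots are inverted with their multiplicities, and the order at `0` is `N - deg f ≤ 1`.
-/
theorem squarefree_reflect {f : ℂ[X]} {N : ℕ} (hf : Squarefree f) (h1 : f.natDegree ≤ N)
    (h2 : N ≤ f.natDegree + 1) : Squarefree (f.reflect N) := by
  apply squarefree_of_forall_not_sq_dvd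
  rintro c ⟨q, hq⟩
  by_cases hc : c = 0
  · subst hc
    rw [map_zero, sub_zero] at hq
    have h3 : (f.reflect N).coeff 0 = 0 := by simp [hq, pow_two, mul_assoc]
    have h4 : (f.reflect N).coeff 1 = 0 := by
      simp [hq, pow_two, mul_assoc, coeff_X_mul (n := 0)]
    rw [coeff_reflect] at h3 h4
    rw [revAt_le (by omega)] at h3
    apply hf.ne_zero
    rw [← leadingCoeff_eq_zero, leadingCoeff]
    rcases h1.eq_or_lt with h | h
    · rw [h]; exact h3
    · rw [revAt_le (by omega)] at h4
      rw [show f.natDegree = N - 1 by omega]; exact h4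
  · have hq0 : q ≠ 0 := by
      rintro rfl
      rw [mul_zero] at hq
      apply hf.ne_zero
      rw [← reflect_reflect f N, hq, reflect_zero]
    have hm : ((X - C c) ^ 2 : ℂ[X]).natDegree = 2 := by simp
    have hdeg : q.natDegree + 2 ≤ N := by
      have := natDegree_reflect_le' h1
      rw [hq, natDegree_mul (pow_ne_zero _ (X_sub_C_ne_zero c)) hq0, hm] at this
      omega
    have h3 : f = ((X - C c) ^ 2).reflect 2 * q.reflect (N - 2) := by
      rw [← reflect_mul _ _ hm.le (by omega), ← reflect_reflect f N, hq]
      congr 1; omega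
    have h4 : ((X - C c) ^ 2).reflect 2 = (1 - C c * X) * (1 - C c * X) := by
      rw [sq, show (2 : ℕ) = 1 + 1 from rfl, reflect_mul _ _ (by simp) (by simp)]
      have : (X - C c).reflect 1 = 1 - C c * X := by
        have := reflect_monomial (R := ℂ) 1 1
        simp only [pow_one] at this
        rw [reflect_sub, reflect_C, this]; simp [revAt_le]
      rw [this]
    have h5 := hf _ (h4 ▸ h3 ▸ dvd_mul_right _ _)
    have h6 := natDegree_eq_zero_of_isUnit h5
    have h7 : (1 - C c * X).natDegree = 1 := by
      rw [sub_eq_add_neg, add_comm, ← neg_mul, ← C_neg, ← C_1]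
      exact natDegree_linear (neg_ne_zero.2 hc)
    omega

namespace IsHyperelliptic

variable {F : Type} [Field F] [Algebra ℂ F] {x v : F} {f : ℂ[X]} {g : ℕ}

/-- The model at infinity. -/
theorem inv (h : IsHyperelliptic x v f) (h1 : 2 * g + 1 ≤ f.natDegree)
    (h2 : f.natDegree ≤ 2 * g + 2) :
    IsHyperelliptic x⁻¹ (v * x⁻¹ ^ (g + 1)) (f.reflect (2 * g + 2)) where
  transcendental := by
    have := h.transcendental
    intro h0
    exact this (by simpa using h0.inv)
  sq := by
    have hx := h.x_ne_zero
    rw [aeval_reflect (inv_ne_zero hx) h2, inv_inv, mul_pow, h.sq, mul_comm]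
    congr 1
    ring
  squarefree := squarefree_reflect h.squarefree h2 (by omega)
  natDegree_pos := by
    have hs := squarefree_reflect h.squarefree h2 (by omega)
    by_contra h0
    have h3 : ∀ i, 0 < i → (f.reflect (2 * g + 2)).coeff i = 0 := fun i hi =>
      coeff_eq_zero_of_natDegree_lt (by omega)
    have h4 : f = C (f.coeff (2 * g + 2)) * X ^ (2 * g + 2) := by
      ext i
      rw [coeff_C_mul_X_pow]
      split_ifs with hi
      · rw [hi]
      · rcases Nat.lt_or_ge (2 * g + 2) i with h5 | h5
        · exact coeff_eq_zero_of_natDegree_lt (by omega)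
        · have := h3 (2 * g + 2 - i) (by omega)
          rwa [coeff_reflect, revAt_le (by omega), Nat.sub_sub_self h5] at this
    -- A constant reflection would make `f` a multiple of `X ^ (2g + 2)`, which is not squarefree.
    have h5 : X * X ∣ f := by
      rw [h4]
      refine ⟨C (f.coeff (2 * g + 2)) * X ^ (2 * g), by ring⟩
    exact not_isUnit_X (h.squarefree X h5)
  adjoin_eq_top := by
    rw [eq_top_iff, ← h.adjoin_eq_top, IntermediateField.adjoin_le_iff]
    have hx := h.x_ne_zero
    set E := IntermediateField.adjoin ℂ {x⁻¹, v * x⁻¹ ^ (g + 1)}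
    have hxE : x⁻¹ ∈ E := IntermediateField.subset_adjoin _ _ (by simp)
    have hvE : v * x⁻¹ ^ (g + 1) ∈ E := IntermediateField.subset_adjoin _ _ (by simp)
    rintro y (rfl | rfl)
    · simpa using inv_mem hxE
    · have := mul_mem hvE (pow_mem (inv_mem hxE) (g + 1))
      rwa [inv_inv, mul_assoc, ← mul_pow, inv_mul_cancel₀ hx, one_pow, mul_one] at this

/-- Where `x` is integral, so is `v`. Since `f` is separable, `α f + β f' = 1`, and `2v dv = f' dx`
gives `dx/v = α v dx + 2β dv`, without any local parameter. -/
theorem smul_mem_span (h : IsHyperelliptic x v f) (O : ValuationSubring F)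
    (hO : ∀ c : ℂ, algebraMap ℂ F c ∈ O) (hx : x ∈ O) (i : ℕ) :
    (x ^ i / v) • KaehlerDifferential.D ℂ F x ∈
      Submodule.span ℂ {ω | ∃ a ∈ O, ∃ b ∈ O, ω = a • KaehlerDifferential.D ℂ F b} := by
  have hp : ∀ p : ℂ[X], aeval x p ∈ O := by
    intro p
    induction p using Polynomial.induction_on' with
    | add p q hp hq => rw [map_add]; exact add_mem hp hq
    | monomial n c => rw [aeval_monomial]; exact mul_mem (hO c) (pow_mem hx n)
  have hv : v ∈ O := by
    have : v ^ 2 ∈ O := h.sq ▸ hp f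
    rcases O.mem_or_inv_mem v with h0 | h0
    · exact h0
    · have hv0 := h.v_ne_zero
      have := mul_mem this h0
      rwa [pow_two, mul_assoc, mul_inv_cancel₀ hv0, mul_one] at this
  have hsep : IsCoprime f (derivative f) := PerfectField.separable_iff_squarefree.2 h.squarefree
  obtain ⟨α, β, hαβ⟩ := hsep
  have h1 := congrArg (aeval x) hαβ
  simp only [map_add, map_mul, map_one] at h1
  have hv0 := h.v_ne_zero
  have hchar := charZero_of_injective_algebraMap (FaithfulSMul.algebraMap_injective ℂ F)
  have h2 : (x ^ i / v) • KaehlerDifferential.D ℂ F x =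
      (x ^ i * aeval x α * v) • KaehlerDifferential.D ℂ F x +
      (2 * x ^ i * aeval x β) • KaehlerDifferential.D ℂ F v := by
    rw [h.D_v, smul_smul, ← add_smul]
    congr 1
    field_simp
    linear_combination (-x ^ i) * h1 - x ^ i * aeval x α * h.sq
  rw [h2]
  have hxi := pow_mem hx i
  refine add_mem (Submodule.subset_span ⟨_, mul_mem (mul_mem hxi (hp α)) hv, x, hx, rfl⟩)
    (Submodule.subset_span ⟨_, mul_mem (mul_mem ?_ hxi) (hp β), v, hv, rfl⟩)
  simp

theorem smul_mem_regularDifferentials (h : IsHyperelliptic x v f) (h1 : 2 * g + 1 ≤ f.natDegree)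
    (h2 : f.natDegree ≤ 2 * g + 2) {i : ℕ} (hi : i < g) :
    (x ^ i / v) • KaehlerDifferential.D ℂ F x ∈ regularDifferentials ℂ F := by
  refine (Submodule.mem_iInf _).2 fun O => (Submodule.mem_iInf _).2 fun hO => ?_
  rcases O.mem_or_inv_mem x with hx | hx
  · exact h.smul_mem_span O hO hx i
  -- At infinity, with `w = 1/x`, the form `x^i dx/v` is `-w^(g-1-i) dw/(v w^(g+1))`; the exponent
  -- is nonnegative because `i < g`.
  · have h3 := (h.inv h1 h2).smul_mem_span O hO hx (g - 1 - i)
    rw [Derivation.leibniz_inv, smul_smul, ← Submodule.neg_mem_iff] at h3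
    convert h3 using 1
    rw [← neg_smul]
    congr 1
    have hx0 := h.x_ne_zero
    have hv0 := h.v_ne_zero
    have : x⁻¹ ^ (g + 1) = x⁻¹ ^ (g - 1 - i) * x⁻¹ ^ 2 * x⁻¹ ^ i := by
      rw [← pow_add, ← pow_add]; congr 1; omega
    rw [this]
    simp only [inv_pow]
    field_simp

/-- The differential has a polynomial form in both charts. Comparing the coefficients of `1` and `v`
equates polynomials in `x` with polynomials in `1/x`, up to explicit powers of `x`; degrees then
force `R = 0` and bound `S`. -/
theorem exists_polynomial_rep_of_natDegree_lt (h : IsHyperelliptic x v f)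
    (h1 : 2 * g + 1 ≤ f.natDegree) (h2 : f.natDegree ≤ 2 * g + 2) {ω : Ω[F⁄ℂ]}
    (hω : ω ∈ regularDifferentials ℂ F) : ∃ S : ℂ[X], S.degree < g ∧
      ω = (aeval x S / v) • KaehlerDifferential.D ℂ F x := by
  obtain ⟨R, S, hRS⟩ := h.exists_polynomial_rep hω
  obtain ⟨R', S', hRS'⟩ := (h.inv h1 h2).exists_polynomial_rep hω
  have hx0 := h.x_ne_zero
  have hv0 := h.v_ne_zero
  rw [Derivation.leibniz_inv, smul_smul, hRS] at hRS'
  have h3 := smul_left_injective F h.D_x_ne_zero hRS'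
  -- Multiplication by `x^N` clears the powers of `1/x` in both `R'(1/x)` and `S'(1/x)`.
  set N := R'.natDegree + S'.natDegree
  have hR' := aeval_reflect hx0 (p := R') (N := N) (by omega)
  have hS' := aeval_reflect hx0 (p := S') (N := N) (by omega)
  have h4 : aeval x (X ^ (N + 2) * S + X ^ (g + 1) * S'.reflect N) +
      aeval x (X ^ (N + 2) * R + R'.reflect N) * v = 0 := by
    simp only [map_add, map_mul, map_pow, aeval_X, hR', hS']
    generalize aeval x⁻¹ R' = r at *
    generalize aeval x⁻¹ S' = s at *
    have h5 : (r + s / (v * x⁻¹ ^ (g + 1))) * -x⁻¹ ^ 2 =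
        -(r + s * x ^ (g + 1) / v) / x ^ 2 := by
      rw [inv_pow, inv_pow]
      field_simp
    rw [h5] at h3
    have h6 : (aeval x R + aeval x S / v) * (x ^ 2 * v) = -(r * v + s * x ^ (g + 1)) := by
      rw [h3]; field_simp
    have h7 : aeval x S / v * v = aeval x S := div_mul_cancel₀ _ hv0
    linear_combination x ^ N * h6 - x ^ (N + 2) * h7
  obtain ⟨h5, h6⟩ := eq_zero_of_add_mul_eq_zero h.transcendental h.sq h.squarefree
    h.natDegree_pos h4
  have hR : R = 0 := by
    by_contra hR
    have h7 := natDegree_reflect_le' (p := R') (N := N) (by omega)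
    rw [← natDegree_neg, ← eq_neg_of_add_eq_zero_left h6,
      natDegree_mul (pow_ne_zero _ X_ne_zero) hR, natDegree_X_pow] at h7
    omega
  refine ⟨S, ?_, by rw [hRS, hR]; simp⟩
  by_cases hS : S = 0
  · rw [hS, degree_zero]; exact WithBot.bot_lt_coe _
  rw [← natDegree_lt_iff_degree_lt hS]
  have h7 := natDegree_reflect_le' (p := S') (N := N) (by omega)
  have h8 : (X ^ (N + 2) * S).natDegree ≤ g + 1 + N := by
    rw [eq_neg_of_add_eq_zero_left h5, natDegree_neg]
    exact natDegree_mul_le_of_le (by simp) h7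
  rw [natDegree_mul (pow_ne_zero _ X_ne_zero) hS, natDegree_X_pow] at h8
  omega

theorem genus_eq (h : IsHyperelliptic x v f)
    (h1 : 2 * g + 1 ≤ f.natDegree) (h2 : f.natDegree ≤ 2 * g + 2) :
    genus ℂ F = g := by
  let T : degreeLT ℂ g →ₗ[ℂ] Ω[F⁄ℂ] :=
    { toFun := fun S => (aeval x (S : ℂ[X]) / v) • KaehlerDifferential.D ℂ F x
      map_add' := fun S S' => by
        rw [← add_smul, ← add_div]; simp
      map_smul' := fun c S => by
        simp [Algebra.smul_def, mul_div_assoc, mul_smul] }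
  have hTi : Function.Injective T := by
    rw [injective_iff_map_eq_zero]
    rintro ⟨S, hS⟩ h0
    have h3 := (smul_eq_zero.1 h0).resolve_right h.D_x_ne_zero
    have h4 : aeval x S = 0 := (div_eq_zero_iff.1 h3).resolve_right h.v_ne_zero
    by_contra hne
    exact h.aeval_ne_zero (fun h5 => hne (by simpa using h5)) h4
  have hTr : LinearMap.range T = regularDifferentials ℂ F := by
    apply le_antisymm
    · rintro _ ⟨⟨S, hS⟩, rfl⟩
      change (aeval x S / v) • KaehlerDifferential.D ℂ F x ∈ _
      rw [aeval_eq_sum_range, Finset.sum_div, Finset.sum_smul]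
      refine sum_mem fun i hi => ?_
      by_cases hSi : S.coeff i = 0
      · simp [hSi]
      · have hlt : i < g := by
          by_contra hge
          exact hSi (coeff_eq_zero_of_degree_lt ((mem_degreeLT.1 hS).trans_le (by exact_mod_cast not_lt.1 hge)))
        rw [smul_div_assoc, smul_assoc]
        exact Submodule.smul_mem _ _ (h.smul_mem_regularDifferentials h1 h2 hlt)
    · intro ω hω
      obtain ⟨S, hS, rfl⟩ := h.exists_polynomial_rep_of_natDegree_lt h1 h2 hω
      exact ⟨⟨S, mem_degreeLT.2 hS⟩, rfl⟩
  rw [genus, ← hTr, LinearMap.finrank_range_of_inj hTi, (degreeLTEquiv ℂ g).finrank_eq]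
  simp

end IsHyperelliptic

/-! ### Palindromic polynomials as polynomials in `x + 1/x` -/

/-- The polynomial `x ^ n * q(x + 1 / x)`, for `q` of degree at most `n`. -/
def palindromize (n : ℕ) (q : ℂ[X]) : ℂ[X] :=
  ∑ i ∈ Finset.range (n + 1), C (q.coeff i) * (X ^ 2 + 1) ^ i * X ^ (n - i)

theorem aeval_palindromize {F : Type*} [Field F] [Algebra ℂ F] {x : F} (hx : x ≠ 0) {n : ℕ}
    {q : ℂ[X]} (hq : q.natDegree ≤ n) :
    aeval x (palindromize n q) = x ^ n * aeval (x + x⁻¹) q := by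
  rw [palindromize, map_sum, aeval_eq_sum_range' (Nat.lt_succ_of_le hq), Finset.mul_sum]
  refine Finset.sum_congr rfl fun i hi => ?_
  have hi' : i ≤ n := Finset.mem_range_succ_iff.1 hi
  obtain ⟨j, rfl⟩ := Nat.exists_eq_add_of_le hi'
  have h1 : x ^ 2 + 1 = x * (x + x⁻¹) := by field_simp
  simp only [map_mul, aeval_C, map_pow, map_add, aeval_X, map_one, h1, Algebra.smul_def]
  rw [Nat.add_sub_cancel_left, mul_pow, pow_add]
  ring

theorem eval_palindromize {c : ℂ} (hc : c ≠ 0) {n : ℕ} {q : ℂ[X]} (hq : q.natDegree ≤ n) :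
    (palindromize n q).eval c = c ^ n * q.eval (c + c⁻¹) := by
  simpa using aeval_palindromize hc hq

theorem eq_of_forall_eval_eq {p q : ℂ[X]} (h : ∀ c ≠ 0, p.eval c = q.eval c) : p = q := by
  apply eq_of_infinite_eval_eq
  exact (Set.finite_singleton (0 : ℂ)).infinite_compl.mono fun c hc => h c hc

theorem palindromize_mul {m n : ℕ} {p q : ℂ[X]} (hp : p.natDegree ≤ m) (hq : q.natDegree ≤ n) :
    palindromize (m + n) (p * q) = palindromize m p * palindromize n q := by
  apply eq_of_forall_eval_eq
  intro c hc
  rw [eval_mul, eval_palindromize hc (natDegree_mul_le_of_le hp hq), eval_palindromize hc hp,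
    eval_palindromize hc hq, eval_mul]
  ring

theorem palindromize_four (q : ℂ[X]) : palindromize 4 q =
    C (q.coeff 4) * X ^ 8 + C (q.coeff 3) * X ^ 7 + C (4 * q.coeff 4 + q.coeff 2) * X ^ 6 +
    C (3 * q.coeff 3 + q.coeff 1) * X ^ 5 + C (6 * q.coeff 4 + 2 * q.coeff 2 + q.coeff 0) * X ^ 4 +
    C (3 * q.coeff 3 + q.coeff 1) * X ^ 3 + C (4 * q.coeff 4 + q.coeff 2) * X ^ 2 +
    C (q.coeff 3) * X + C (q.coeff 4) := by
  simp only [palindromize, Finset.sum_range_succ, Finset.sum_range_zero, map_add, map_mul,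
    map_ofNat]
  ring

theorem natDegree_palindromize_four {q : ℂ[X]} (h3 : 3 ≤ q.natDegree) (h4 : q.natDegree ≤ 4) :
    7 ≤ (palindromize 4 q).natDegree ∧ (palindromize 4 q).natDegree ≤ 8 := by
  have h8 : (palindromize 4 q).coeff 8 = q.coeff 4 := by
    rw [palindromize_four]
    simp only [coeff_add, coeff_C_mul, coeff_X_pow, coeff_X, coeff_C]; norm_num
  have h7 : (palindromize 4 q).coeff 7 = q.coeff 3 := by
    rw [palindromize_four]
    simp only [coeff_add, coeff_C_mul, coeff_X_pow, coeff_X, coeff_C]; norm_num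
  have hne : q.coeff q.natDegree ≠ 0 := by
    rw [coeff_natDegree, leadingCoeff_ne_zero]; rintro rfl; simp at h3
  constructor
  · rcases (by omega : q.natDegree = 3 ∨ q.natDegree = 4) with h | h
    · rw [h, ← h7] at hne
      exact le_natDegree_of_ne_zero hne
    · rw [h, ← h8] at hne
      exact (by norm_num : 7 ≤ 8).trans (le_natDegree_of_ne_zero hne)
  · rw [palindromize_four]
    compute_degree

/-- The map `x ↦ x + 1/x` on `ℂ*` ramifies only at `x = ±1`, above `t = ±2`, where `q` does not
vanish. At `x = 0` the two lowest coefficients are `q₄` and `q₃`, which are not both zero. -/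
theorem squarefree_palindromize {q : ℂ[X]} (hq : Squarefree q) (h3 : 3 ≤ q.natDegree)
    (h4 : q.natDegree ≤ 4) (h2 : q.eval 2 ≠ 0) (h2' : q.eval (-2) ≠ 0) :
    Squarefree (palindromize 4 q) := by
  apply squarefree_of_forall_not_sq_dvd
  intro c hc
  by_cases hc0 : c = 0
  · subst hc0
    rw [map_zero, sub_zero] at hc
    obtain ⟨r, hr⟩ := hc
    have h0 : (palindromize 4 q).coeff 0 = q.coeff 4 := by
      rw [palindromize_four]; simp
    have h1 : (palindromize 4 q).coeff 1 = q.coeff 3 := by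
      rw [palindromize_four]
      simp only [coeff_add, coeff_C_mul, coeff_X_pow, coeff_X, coeff_C]; norm_num
    rw [hr] at h0 h1
    have h0' : q.coeff 4 = 0 := by rw [← h0]; simp [pow_two, mul_assoc]
    have h1' : q.coeff 3 = 0 := by rw [← h1]; simp [pow_two, mul_assoc, coeff_X_mul (n := 0)]
    have hne : q.coeff q.natDegree ≠ 0 := by
      rw [coeff_natDegree, leadingCoeff_ne_zero]; rintro rfl; simp at h3
    rcases (by omega : q.natDegree = 3 ∨ q.natDegree = 4) with h | h <;> rw [h] at hne
    exacts [hne h1', hne h0']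
  · set τ := c + c⁻¹ with hτ
    have hroot : q.eval τ = 0 := by
      have h5 : (palindromize 4 q).eval c = 0 :=
        (dvd_iff_isRoot.1 ((dvd_pow_self _ two_ne_zero).trans hc))
      rw [eval_palindromize hc0 h4] at h5
      exact (mul_eq_zero.1 h5).resolve_left (pow_ne_zero _ hc0)
    obtain ⟨r, hr⟩ := dvd_iff_isRoot.2 hroot
    have hq0 : q ≠ 0 := hq.ne_zero
    have hr0 : r ≠ 0 := by rintro rfl; exact hq0 (by simpa using hr)
    have hrd : r.natDegree ≤ 3 := by
      rw [hr, natDegree_mul (X_sub_C_ne_zero τ) hr0, natDegree_X_sub_C] at h4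
      omega
    -- A simple root `τ = c + 1/c` pulls back to the two roots `c` and `1/c`; a double root at `c`
    -- needs `c = 1/c` or a second factor `t - τ` in `q`.
    have h6 : palindromize 1 (X - C τ) = (X - C c) * (X - C c⁻¹) := by
      have h7 : C c * C c⁻¹ = (1 : ℂ[X]) := by rw [← C_mul, mul_inv_cancel₀ hc0, C_1]
      simp only [palindromize, Finset.sum_range_succ, Finset.sum_range_zero, coeff_sub, coeff_X,
        coeff_C, hτ]
      simp
      linear_combination -h7
    have h8 : palindromize 4 q = (X - C c) * ((X - C c⁻¹) * palindromize 3 r) := by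
      rw [hr, show (4 : ℕ) = 1 + 3 from rfl, palindromize_mul (by simp) hrd, h6, mul_assoc]
    rw [h8, pow_two] at hc
    have h9 := (mul_dvd_mul_iff_left (X_sub_C_ne_zero c)).1 hc
    have h10 := dvd_iff_isRoot.1 h9
    rw [IsRoot.def, eval_mul, eval_palindromize hc0 hrd] at h10
    rcases mul_eq_zero.1 h10 with h11 | h11
    · have h12 : c = c⁻¹ := by simpa [sub_eq_zero] using h11
      have h13 : c * c = 1 := by nth_rw 2 [h12]; exact mul_inv_cancel₀ hc0
      rcases mul_self_eq_one_iff.1 h13 with h | h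
      · rw [hτ, h] at hroot
        apply h2
        rw [← hroot]; norm_num
      · rw [hτ, h] at hroot
        apply h2'
        rw [← hroot]; norm_num
    · have h12 := (mul_eq_zero.1 h11).resolve_left (pow_ne_zero _ hc0)
      have h13 : (X - C τ) * (X - C τ) ∣ q := by
        rw [hr]
        exact mul_dvd_mul_left _ (dvd_iff_isRoot.2 h12)
      exact not_isUnit_X_sub_C τ (hq _ h13)

/-! ### The double cover, its involution and the quotient -/

/-- The data showing that `A(x) y² + M(x) y + x ^ d A(1 / x)` is birational to
`v² = x⁴ q(x + 1 / x)`. -/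
structure HyperellipticModel (d e : ℕ) (A M S q : ℂ[X]) : Prop where
  natDegree_A : A.natDegree ≤ d
  natDegree_M : M.natDegree ≤ d
  natDegree_S : S.natDegree ≤ d
  A_ne_zero : A ≠ 0
  S_ne_zero : S ≠ 0
  coprime : ∀ c, A.eval c = 0 → S.eval c ≠ 0
  reflect_A : A.reflect d = X ^ e * A
  reflect_M : M.reflect d = M
  reflect_S : S.reflect d = -(X ^ 4 * S)
  discr : M ^ 2 - 4 * X ^ e * A ^ 2 = S ^ 2 * palindromize 4 q
  squarefree : Squarefree q
  le_natDegree : 3 ≤ q.natDegree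
  natDegree_le : q.natDegree ≤ 4
  eval_two : q.eval 2 ≠ 0
  eval_neg_two : q.eval (-2) ≠ 0

namespace HyperellipticModel

variable {d e : ℕ} {A M S q : ℂ[X]}

theorem natDegree_quadraticInY (hA : A ≠ 0) : (quadraticInY d A M).natDegree = 2 := by
  rw [quadraticInY]
  exact natDegree_quadratic hA

theorem coeff_quadraticInY : (quadraticInY d A M).coeff 0 = A.reflect d ∧
    (quadraticInY d A M).coeff 1 = M ∧ (quadraticInY d A M).coeff 2 = A := by
  simp [quadraticInY, coeff_X, coeff_C]

/-- A root `c` of a factor in `x` alone is a common root of `A` and `M`, hence a double root of the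
discriminant; as `S(c) ≠ 0`, it would be a double root of the squarefree part. -/
theorem isUnit_of_C_mul (h : HyperellipticModel d e A M S q) {G H : ℂ[X][Y]}
    (hGH : quadraticInY d A M = G * H) (hG : G.natDegree = 0) : IsUnit G := by
  obtain ⟨-, h1, h2⟩ := coeff_quadraticInY (d := d) (A := A) (M := M)
  rw [eq_C_of_natDegree_eq_zero hG] at hGH ⊢
  set g := G.coeff 0
  rw [hGH, coeff_C_mul] at h1 h2
  rw [isUnit_C]
  by_contra hu
  obtain ⟨c, hc⟩ := IsAlgClosed.exists_root g (fun h0 => hu (isUnit_iff_degree_eq_zero.2 h0))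
  have hcg := dvd_iff_isRoot.2 hc
  have hA : X - C c ∣ A := hcg.trans ⟨_, h2.symm⟩
  have hM : X - C c ∣ M := hcg.trans ⟨_, h1.symm⟩
  have hS : ¬ X - C c ∣ S := fun h0 => h.coprime c (dvd_iff_isRoot.1 hA) (dvd_iff_isRoot.1 h0)
  have h3 : (X - C c) ^ 2 ∣ S ^ 2 * palindromize 4 q := by
    rw [← h.discr]
    exact dvd_sub (pow_dvd_pow_of_dvd hM 2) ((pow_dvd_pow_of_dvd hA 2).mul_left _)
  have h4 : IsCoprime ((X - C c) ^ 2) (S ^ 2) :=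
    (((prime_X_sub_C c).irreducible.coprime_iff_not_dvd).2 hS).pow
  have h5 := h4.dvd_of_dvd_mul_left h3
  rw [pow_two] at h5
  exact not_isUnit_X_sub_C c (squarefree_palindromize h.squarefree h.le_natDegree h.natDegree_le
    h.eval_two h.eval_neg_two _ h5)

theorem irreducible (h : HyperellipticModel d e A M S q) : Irreducible (quadraticInY d A M) := by
  have hdeg := natDegree_quadraticInY (d := d) (M := M) h.A_ne_zero
  refine ⟨fun hu => ?_, fun G H hGH => ?_⟩
  · have := natDegree_eq_zero_of_isUnit hu
    omega
  have hP0 : quadraticInY d A M ≠ 0 := by rintro h0; simp [h0] at hdeg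
  have hG0 : G ≠ 0 := by rintro rfl; exact hP0 (by simpa using hGH)
  have hH0 : H ≠ 0 := by rintro rfl; exact hP0 (by simpa using hGH)
  have hsum : G.natDegree + H.natDegree = 2 := by rw [← natDegree_mul hG0 hH0, ← hGH, hdeg]
  rcases Nat.eq_zero_or_pos G.natDegree with hG | hG
  · exact Or.inl (h.isUnit_of_C_mul hGH hG)
  rcases Nat.eq_zero_or_pos H.natDegree with hH | hH
  · exact Or.inr (h.isUnit_of_C_mul (hGH.trans (mul_comm _ _)) hH)
  exfalso
  have hG1 : G.natDegree ≤ 1 := by omega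
  have hH1 : H.natDegree ≤ 1 := by omega
  obtain ⟨h0, h1, h2⟩ := coeff_quadraticInY (d := d) (A := A) (M := M)
  rw [hGH, eq_X_add_C_of_natDegree_le_one hG1, eq_X_add_C_of_natDegree_le_one hH1] at h0 h1 h2
  set g1 := G.coeff 1
  set g0 := G.coeff 0
  set k1 := H.coeff 1
  set k0 := H.coeff 0
  have hexp : (C g1 * X + C g0) * (C k1 * X + C k0) =
      C (g1 * k1) * X ^ 2 + C (g1 * k0 + g0 * k1) * X + C (g0 * k0) := by
    simp only [map_add, map_mul]; ring
  rw [hexp] at h0 h1 h2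
  simp only [coeff_add, coeff_C_mul, coeff_X_pow, coeff_X, coeff_C] at h0 h1 h2
  norm_num at h0 h1 h2
  -- Two factors linear in `y` make the discriminant a perfect square.
  have h3 : (g1 * k0 - g0 * k1) ^ 2 = palindromize 4 q * S ^ 2 := by
    rw [mul_comm (palindromize 4 q), ← h.discr]
    have := h.reflect_A
    linear_combination (M + g1 * k0 + g0 * k1) * h1 - 4 * A * h0 - 4 * A * this -
      4 * (g0 * k0) * h2
  refine h.S_ne_zero (eq_zero_of_sq_eq_mul_sq (squarefree_palindromize h.squarefree h.le_natDegree
    h.natDegree_le h.eval_two h.eval_neg_two) ?_ h3)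
  have := natDegree_palindromize_four h.le_natDegree h.natDegree_le
  omega

end HyperellipticModel

namespace HyperellipticModel

variable {d e : ℕ} {A M S q : ℂ[X]}

theorem aeval_xFun {P : ℂ[X][Y]} [Fact (Irreducible P)] (p : ℂ[X]) :
    aeval (xFun P) p = algebraMap (AdjoinRoot P) (FunctionField P) (AdjoinRoot.of P p) := by
  let ψ : ℂ[X] →ₐ[ℂ] FunctionField P := (IsScalarTower.toAlgHom ℂ (AdjoinRoot P) _).comp
    (IsScalarTower.toAlgHom ℂ ℂ[X] (AdjoinRoot P))
  have h := aeval_algHom_apply ψ X p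
  rw [aeval_X_left_apply] at h
  exact h

theorem transcendental_xFun {P : ℂ[X][Y]} [Fact (Irreducible P)] (hP : 0 < P.natDegree) :
    Transcendental ℂ (xFun P) := by
  rw [transcendental_iff]
  intro p hp
  rw [aeval_xFun] at hp
  have h1 : AdjoinRoot.mk P (C p) = 0 :=
    (FaithfulSMul.algebraMap_injective (AdjoinRoot P) (FunctionField P)) (by rw [map_zero]; exact hp)
  rw [AdjoinRoot.mk_eq_zero] at h1
  by_contra h0
  have := natDegree_le_of_dvd h1 (C_ne_zero.2 h0)
  rw [natDegree_C] at this
  omega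

theorem aeval_mk {P : ℂ[X][Y]} [Fact (Irreducible P)] (p : ℂ[X][Y]) :
    algebraMap (AdjoinRoot P) (FunctionField P) (AdjoinRoot.mk P p) =
      p.eval₂ (aeval (xFun P) : ℂ[X] →ₐ[ℂ] FunctionField P).toRingHom (yFun P) := by
  induction p using Polynomial.induction_on' with
  | add p q hp hq => rw [map_add, map_add, hp, hq, eval₂_add]
  | monomial n c =>
    rw [eval₂_monomial, ← C_mul_X_pow_eq_monomial, map_mul, map_mul, map_pow, map_pow]
    congr 1
    exact (aeval_xFun c).symm

theorem eval₂_xFun_yFun {P : ℂ[X][Y]} [Fact (Irreducible P)] :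
    P.eval₂ (aeval (xFun P) : ℂ[X] →ₐ[ℂ] FunctionField P).toRingHom (yFun P) = 0 := by
  rw [← aeval_mk, AdjoinRoot.mk_self, map_zero]

theorem adjoin_xFun_yFun {P : ℂ[X][Y]} [Fact (Irreducible P)] :
    IntermediateField.adjoin ℂ {xFun P, yFun P} = ⊤ := by
  set E := IntermediateField.adjoin ℂ {xFun P, yFun P}
  have hxE : xFun P ∈ E := IntermediateField.subset_adjoin _ _ (by simp)
  have hyE : yFun P ∈ E := IntermediateField.subset_adjoin _ _ (by simp)
  have hp : ∀ p : ℂ[X], aeval (xFun P) p ∈ E := by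
    intro p
    induction p using Polynomial.induction_on' with
    | add p q hp hq => rw [map_add]; exact add_mem hp hq
    | monomial n c => rw [aeval_monomial]; exact mul_mem (E.algebraMap_mem c) (pow_mem hxE n)
  have hR : ∀ r : AdjoinRoot P, algebraMap (AdjoinRoot P) (FunctionField P) r ∈ E := by
    intro r
    obtain ⟨p, rfl⟩ := AdjoinRoot.mk_surjective r
    rw [aeval_mk, eval₂_eq_sum_range]
    exact sum_mem fun i _ => mul_mem (hp _) (pow_mem hyE i)
  rw [eq_top_iff]
  rintro z -
  obtain ⟨a, b, hb, rfl⟩ := IsFractionRing.div_surjective (A := AdjoinRoot P) z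
  exact div_mem (hR a) (hR b)

variable {F : Type} [Field F] [Algebra ℂ F]

/-- The function `v` on the curve `P(x, y) = 0` satisfying `v ^ 2 = x ^ 4 * q(x + 1 / x)`. -/
def vFun (A M S : ℂ[X]) (x y : F) : F := (2 * aeval x A * y + aeval x M) / aeval x S

theorem isHyperelliptic (h : HyperellipticModel d e A M S q) {x y : F} (hx : Transcendental ℂ x)
    (hxy : aeval x A * y ^ 2 + aeval x M * y + aeval x (A.reflect d) = 0)
    (hadj : IntermediateField.adjoin ℂ {x, y} = ⊤) :
    IsHyperelliptic x (vFun A M S x y) (palindromize 4 q) := by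
  have hne : ∀ {p : ℂ[X]}, p ≠ 0 → aeval x p ≠ 0 := fun hp h0 => hp (transcendental_iff.1 hx _ h0)
  have hS := hne h.S_ne_zero
  have hA := hne h.A_ne_zero
  refine ⟨hx, ?_, squarefree_palindromize h.squarefree h.le_natDegree h.natDegree_le
    h.eval_two h.eval_neg_two, ?_, ?_⟩
  · have h1 := congrArg (aeval x) h.discr
    simp only [map_sub, map_mul, map_pow, aeval_X, map_ofNat] at h1
    rw [h.reflect_A] at hxy
    simp only [map_mul, map_pow, aeval_X] at hxy
    rw [vFun, div_pow, div_eq_iff (pow_ne_zero _ hS)]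
    linear_combination 4 * aeval x A * hxy + h1
  · have := natDegree_palindromize_four h.le_natDegree h.natDegree_le
    omega
  · rw [eq_top_iff, ← hadj, IntermediateField.adjoin_le_iff]
    set E := IntermediateField.adjoin ℂ {x, vFun A M S x y}
    have hxE : x ∈ E := IntermediateField.subset_adjoin _ _ (by simp)
    have hvE : vFun A M S x y ∈ E := IntermediateField.subset_adjoin _ _ (by simp)
    have hp : ∀ p : ℂ[X], aeval x p ∈ E := by
      intro p
      induction p using Polynomial.induction_on' with
      | add p q hp hq => rw [map_add]; exact add_mem hp hq
      | monomial n c => rw [aeval_monomial]; exact mul_mem (E.algebraMap_mem c) (pow_mem hxE n)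
    have hchar := charZero_of_injective_algebraMap (FaithfulSMul.algebraMap_injective ℂ F)
    have hy : y = (aeval x S * vFun A M S x y - aeval x M) / aeval x (2 * A) := by
      rw [vFun, map_mul, map_ofNat]
      field_simp
      ring
    rintro z (rfl | rfl)
    · exact hxE
    · rw [hy]
      exact div_mem (sub_mem (mul_mem (hp _) hvE) (hp _)) (hp _)

/-- The sign in `v ↦ v/x⁴` matters: since `x^d S(1/x) = -x⁴ S(x)`, this lift of `x ↦ 1/x`
interchanges the two roots in `y` up to the factor `x^e`, as inversion of `y` requires. The other
lift has a quotient of genus 2. -/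
theorem exists_involution (h : HyperellipticModel d e A M S q) {x y : F} (hx : Transcendental ℂ x)
    (hxy : aeval x A * y ^ 2 + aeval x M * y + aeval x (A.reflect d) = 0)
    (hadj : IntermediateField.adjoin ℂ {x, y} = ⊤) :
    ∃ σ : F ≃ₐ[ℂ] F, σ x = x⁻¹ ∧ σ y = y⁻¹ ∧ σ (vFun A M S x y) = vFun A M S x y / x ^ 4 := by
  have hH := h.isHyperelliptic hx hxy hadj
  have hx0 := hH.x_ne_zero
  have hS := hH.aeval_ne_zero h.S_ne_zero
  have hA := hH.aeval_ne_zero h.A_ne_zero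
  have hchar := charZero_of_injective_algebraMap (FaithfulSMul.algebraMap_injective ℂ F)
  set v := vFun A M S x y with hv
  have hvq : v ^ 2 = x ^ 4 * aeval (x + x⁻¹) q := by
    rw [hH.sq, aeval_palindromize hx0 h.natDegree_le]
  obtain ⟨φ, hφx, hφv⟩ := hH.exists_lift (x' := x⁻¹) (v' := v / x ^ 4)
    (fun h0 => hx (by simpa using h0.inv)) (by
      rw [aeval_palindromize (inv_ne_zero hx0) h.natDegree_le, inv_inv, add_comm x⁻¹, div_pow, hvq]
      field_simp)
  have hφφ : φ.comp φ = AlgHom.id ℂ F := by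
    apply hH.algHom_ext
    · simp [hφx]
    · simp [hφx, hφv]
      field_simp
  refine ⟨AlgEquiv.ofAlgHom φ φ hφφ hφφ, hφx, ?_, hφv⟩
  change φ y = y⁻¹
  have hxd : x ^ d ≠ 0 := pow_ne_zero _ hx0
  have h1 := aeval_reflect hx0 h.natDegree_A
  have h2 := aeval_reflect hx0 h.natDegree_M
  have h3 := aeval_reflect hx0 h.natDegree_S
  rw [h.reflect_A] at h1
  rw [h.reflect_M] at h2
  rw [h.reflect_S] at h3
  have h4 := congrArg (aeval x) h.discr
  simp only [map_sub, map_mul, map_pow, aeval_X, map_ofNat, map_neg, ← hH.sq] at h1 h2 h3 h4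
  have hy : 2 * aeval x A * y = aeval x S * v - aeval x M := by
    rw [hv, vFun]
    field_simp
    ring
  have hy' := congrArg φ hy
  simp only [map_sub, map_mul, ← aeval_algHom_apply, hφx, hφv, map_ofNat] at hy'
  apply eq_inv_of_mul_eq_one_left
  -- Thus `x^e φ(y)` is the conjugate root of the quadratic; the product of the two roots is `C_d/A
  -- = x^e`, so `y φ(y) = 1`.
  have h5 : 2 * (x ^ e * aeval x A) * φ y = -(aeval x S * v + aeval x M) := by
    rw [h1, h2]
    have : v = x ^ 4 * (v / x ^ 4) := by field_simp
    rw [this]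
    linear_combination x ^ d * hy' - (v / x ^ 4) * h3
  have h6 : (4 * x ^ e * aeval x A ^ 2) ≠ 0 :=
    mul_ne_zero (mul_ne_zero (by norm_num) (pow_ne_zero _ hx0)) (pow_ne_zero _ hA)
  apply mul_left_cancel₀ h6
  linear_combination (2 * aeval x A * y) * h5 - (aeval x S * v + aeval x M) * hy + h4

/-- With `t = x + 1/x` and `u = v/x²`, the whole field is `E₀ + E₀ x` for `E₀ = ℂ(t, u)`. As `σ`
fixes `E₀` and moves `x`, the fixed field is `E₀`. -/
theorem isHyperelliptic_fixedField (h : HyperellipticModel d e A M S q) {x v : F}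
    (hH : IsHyperelliptic x v (palindromize 4 q)) (σ : F ≃ₐ[ℂ] F) (hσx : σ x = x⁻¹)
    (hσv : σ v = v / x ^ 4) :
    ∃ t u : IntermediateField.fixedField (Subgroup.zpowers σ), IsHyperelliptic t u q := by
  have hx0 := hH.x_ne_zero
  set E := IntermediateField.fixedField (Subgroup.zpowers σ)
  have hE : ∀ z : F, z ∈ E ↔ σ z = z := by
    intro z
    rw [IntermediateField.mem_fixedField_iff]
    refine ⟨fun h0 => h0 σ (Subgroup.mem_zpowers σ), fun h0 τ hτ => ?_⟩
    have : Subgroup.zpowers σ ≤ MulAction.stabilizer (F ≃ₐ[ℂ] F) z := by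
      rw [Subgroup.zpowers_le]
      exact h0
    exact this hτ
  have ht : x + x⁻¹ ∈ E := by rw [hE, map_add, map_inv₀, hσx, inv_inv, add_comm]
  have hu : v / x ^ 2 ∈ E := by
    rw [hE, map_div₀, map_pow, hσx, hσv]
    field_simp
  have hEx : ∀ z : F, z ∈ IntermediateField.adjoin ℂ {x + x⁻¹, v / x ^ 2} → z ∈ E := by
    have : IntermediateField.adjoin ℂ {x + x⁻¹, v / x ^ 2} ≤ E := by
      rw [IntermediateField.adjoin_le_iff]
      rintro z (rfl | rfl)
      exacts [ht, hu]
    exact fun z hz => this hz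
  refine ⟨⟨x + x⁻¹, ht⟩, ⟨v / x ^ 2, hu⟩, ?_, ?_, h.squarefree, ?_, ?_⟩
  · rw [← transcendental_algebraMap_iff (FaithfulSMul.algebraMap_injective E F)]
    change Transcendental ℂ (x + x⁻¹)
    intro h0
    apply hH.transcendental
    have hchar := charZero_of_injective_algebraMap (FaithfulSMul.algebraMap_injective ℂ F)
    have h2 : IsAlgebraic ℂ ((x + x⁻¹) / 2) := by
      rw [div_eq_mul_inv]
      exact h0.mul (IsAlgebraic.inv (map_ofNat (algebraMap ℂ F) 2 ▸ isAlgebraic_algebraMap 2))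
    -- Complete the square in `x² - t x + 1 = 0`: `x` would be algebraic along with `t`.
    have h3 : IsAlgebraic ℂ ((x - (x + x⁻¹) / 2) ^ 2) := by
      have : (x - (x + x⁻¹) / 2) ^ 2 = ((x + x⁻¹) / 2) ^ 2 - 1 := by field_simp; ring
      rw [this]
      exact (h2.pow 2).sub isAlgebraic_one
    have h4 := (h3.of_pow two_pos).add h2
    simpa using h4
  · apply Subtype.ext
    have : ((aeval (⟨x + x⁻¹, ht⟩ : E) q : E) : F) = aeval (x + x⁻¹) q :=
      (aeval_algebraMap_apply F (⟨x + x⁻¹, ht⟩ : E) q).symm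
    rw [this]
    change (v / x ^ 2) ^ 2 = _
    rw [div_pow, hH.sq, aeval_palindromize hx0 h.natDegree_le]
    field_simp
  · have := h.le_natDegree
    omega
  · set E₀ := IntermediateField.adjoin ℂ {x + x⁻¹, v / x ^ 2} with hE₀
    have ht₀ : x + x⁻¹ ∈ E₀ := IntermediateField.subset_adjoin _ _ (by simp)
    have hu₀ : v / x ^ 2 ∈ E₀ := IntermediateField.subset_adjoin _ _ (by simp)
    have hdec : ∀ z : F, ∃ α ∈ E₀, ∃ β ∈ E₀, z = α + β * x := by
      intro z
      have hz : z ∈ IntermediateField.adjoin ℂ {x, v} :=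
        hH.adjoin_eq_top ▸ IntermediateField.mem_top
      induction hz using IntermediateField.adjoin_induction with
      | mem y hy =>
        rcases hy with rfl | rfl
        · exact ⟨0, zero_mem _, 1, one_mem _, by ring⟩
        -- From `x² = t x - 1`, one has `v = u x² = -u + u t x`.
        · refine ⟨-(y / x ^ 2), neg_mem hu₀, y / x ^ 2 * (x + x⁻¹), mul_mem hu₀ ht₀, ?_⟩
          field_simp
          ring
      | algebraMap c => exact ⟨algebraMap ℂ F c, E₀.algebraMap_mem c, 0, zero_mem _, by ring⟩
      | add y z _ _ hy hz =>
        obtain ⟨α, hα, β, hβ, rfl⟩ := hy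
        obtain ⟨γ, hγ, δ, hδ, rfl⟩ := hz
        exact ⟨α + γ, add_mem hα hγ, β + δ, add_mem hβ hδ, by ring⟩
      | mul y z _ _ hy hz =>
        obtain ⟨α, hα, β, hβ, rfl⟩ := hy
        obtain ⟨γ, hγ, δ, hδ, rfl⟩ := hz
        refine ⟨α * γ - β * δ, sub_mem (mul_mem hα hγ) (mul_mem hβ hδ),
          α * δ + β * γ + β * δ * (x + x⁻¹), add_mem (add_mem (mul_mem hα hδ) (mul_mem hβ hγ))
            (mul_mem (mul_mem hβ hδ) ht₀), ?_⟩
        field_simp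
        ring
      | inv y _ hy =>
        obtain ⟨α, hα, β, hβ, rfl⟩ := hy
        by_cases h0 : α + β * x = 0
        · exact ⟨0, zero_mem _, 0, zero_mem _, by simp [h0]⟩
        have h1 : α + β * x⁻¹ ≠ 0 := by
          have h2 : σ (α + β * x) ≠ 0 := (map_ne_zero σ).2 h0
          rwa [map_add, map_mul, hσx, (hE α).1 (hEx α hα), (hE β).1 (hEx β hβ)] at h2
        -- The norm of `α + β x`, with conjugate `α + β/x`.
        have hN : α ^ 2 + α * β * (x + x⁻¹) + β ^ 2 = (α + β * x) * (α + β * x⁻¹) := by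
          field_simp; ring
        have hNE : α ^ 2 + α * β * (x + x⁻¹) + β ^ 2 ∈ E₀ :=
          add_mem (add_mem (pow_mem hα 2) (mul_mem (mul_mem hα hβ) ht₀)) (pow_mem hβ 2)
        refine ⟨(α + β * (x + x⁻¹)) / (α ^ 2 + α * β * (x + x⁻¹) + β ^ 2),
          div_mem (add_mem hα (mul_mem hβ ht₀)) hNE,
          -β / (α ^ 2 + α * β * (x + x⁻¹) + β ^ 2), div_mem (neg_mem hβ) hNE, ?_⟩
        rw [hN, div_mul_eq_mul_div, ← add_div, eq_div_iff (mul_ne_zero h0 h1), ← mul_assoc,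
          inv_mul_cancel₀ h0]
        ring
    have hle : ∀ z ∈ E, z ∈ E₀ := by
      intro z hz
      obtain ⟨α, hα, β, hβ, rfl⟩ := hdec z
      rw [hE, map_add, map_mul, hσx, (hE α).1 (hEx α hα), (hE β).1 (hEx β hβ), add_right_inj] at hz
      by_cases hβ0 : β = 0
      · simpa [hβ0] using hα
      · exfalso
        have h1 := mul_left_cancel₀ hβ0 hz
        have h2 : aeval x (X ^ 2 - 1 : ℂ[X]) = 0 := by
          simp only [map_sub, map_pow, aeval_X, map_one]
          rw [pow_two]; nth_rw 1 [← h1]; rw [inv_mul_cancel₀ hx0, sub_self]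
        refine hH.aeval_ne_zero ?_ h2
        exact (monic_X_pow_sub_C (1 : ℂ) two_ne_zero).ne_zero
    rw [eq_top_iff]
    rintro ⟨z, hz⟩ -
    have h1 := IntermediateField.adjoin_map ℂ
      {(⟨x + x⁻¹, ht⟩ : E), (⟨v / x ^ 2, hu⟩ : E)} E.val
    rw [Set.image_pair] at h1
    have h2 : z ∈ (IntermediateField.adjoin ℂ
      {(⟨x + x⁻¹, ht⟩ : E), (⟨v / x ^ 2, hu⟩ : E)}).map E.val := by
      rw [h1]; exact hle z hz
    obtain ⟨w, hw, hwz⟩ := h2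
    have : w = ⟨z, hz⟩ := Subtype.ext hwz
    exact this ▸ hw

theorem definesCurveOfGenus_and_quotientHasGenus (h : HyperellipticModel d e A M S q) :
    DefinesCurveOfGenus (quadraticInY d A M) 3 ∧ QuotientHasGenus (quadraticInY d A M) 1 := by
  set P := quadraticInY d A M with hP
  have hirr : Irreducible P := h.irreducible
  have : Fact (Irreducible P) := ⟨hirr⟩
  have hdeg : P.natDegree = 2 := natDegree_quadraticInY h.A_ne_zero
  have hx : Transcendental ℂ (xFun P) := transcendental_xFun (by omega)
  have hxy : aeval (xFun P) A * yFun P ^ 2 + aeval (xFun P) M * yFun P +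
      aeval (xFun P) (A.reflect d) = 0 := by
    have h0 := eval₂_xFun_yFun (P := P)
    conv at h0 => lhs; arg 3; rw [hP, quadraticInY]
    simpa using h0
  have hadj := adjoin_xFun_yFun (P := P)
  have hH := h.isHyperelliptic hx hxy hadj
  obtain ⟨h7, h8⟩ := natDegree_palindromize_four h.le_natDegree h.natDegree_le
  obtain ⟨σ, hσx, hσy, hσv⟩ := h.exists_involution hx hxy hadj
  obtain ⟨t, u, htu⟩ := h.isHyperelliptic_fixedField hH σ hσx hσv
  exact ⟨⟨hirr, hH.genus_eq (by omega) (by omega)⟩, ⟨hirr, σ, hσx, hσy,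
    htu.genus_eq h.le_natDegree h.natDegree_le⟩⟩

end HyperellipticModel

/-! ### Newton polygon and temperedness -/

section NewtonPolygon

/-- The coefficient of `x ^ i`, for an arbitrary integer `i`. -/
def intCoeff (p : ℂ[X]) (i : ℤ) : ℂ := if 0 ≤ i then p.coeff i.toNat else 0

theorem intCoeff_natCast (p : ℂ[X]) (n : ℕ) : intCoeff p n = p.coeff n := by simp [intCoeff]

theorem intCoeff_of_neg (p : ℂ[X]) {i : ℤ} (hi : i < 0) : intCoeff p i = 0 := by
  rw [intCoeff, if_neg (by omega)]

theorem intCoeff_reflect {p : ℂ[X]} {d : ℕ} (hp : p.natDegree ≤ d) (i : ℤ) :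
    intCoeff (p.reflect d) i = intCoeff p (d - i) := by
  rcases lt_or_ge i 0 with hi | hi
  · rw [intCoeff_of_neg _ hi]
    obtain ⟨n, hn⟩ := Int.eq_ofNat_of_zero_le (by omega : 0 ≤ d - i)
    rw [hn, intCoeff_natCast, coeff_eq_zero_of_natDegree_lt (by omega)]
  · obtain ⟨n, rfl⟩ := Int.eq_ofNat_of_zero_le hi
    rw [intCoeff_natCast, coeff_reflect]
    rcases le_or_gt n d with h | h
    · rw [revAt_le h, ← Int.ofNat_sub h, intCoeff_natCast]
    · rw [revAt_eq_self_of_lt h, intCoeff_of_neg _ (by omega),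
        coeff_eq_zero_of_natDegree_lt (by omega)]

theorem intCoeff_X_pow_mul (p : ℂ[X]) (e : ℕ) (i : ℤ) :
    intCoeff (X ^ e * p) i = intCoeff p (i - e) := by
  rcases lt_or_ge i 0 with hi | hi
  · rw [intCoeff_of_neg _ hi, intCoeff_of_neg _ (by omega)]
  · obtain ⟨n, rfl⟩ := Int.eq_ofNat_of_zero_le hi
    rw [intCoeff_natCast, coeff_X_pow_mul']
    split_ifs with h
    · rw [← Int.ofNat_sub h, intCoeff_natCast]
    · rw [intCoeff_of_neg _ (by omega)]

variable {d e : ℕ} {A M : ℂ[X]}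

theorem coeffAt_quadraticInY (i j : ℤ) : coeffAt (quadraticInY d A M) (i, j) =
    if j = 0 then intCoeff (A.reflect d) i else if j = 1 then intCoeff M i
    else if j = 2 then intCoeff A i else 0 := by
  rcases lt_or_ge j 0 with hj | hj
  · rw [coeffAt, if_neg (by simp; omega), if_neg (by omega), if_neg (by omega), if_neg (by omega)]
  · obtain ⟨n, rfl⟩ := Int.eq_ofNat_of_zero_le hj
    obtain ⟨h0, h1, h2⟩ := HyperellipticModel.coeff_quadraticInY (d := d) (A := A) (M := M)
    rw [coeffAt]
    simp only [hj, and_true, Int.toNat_natCast]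
    match n with
    | 0 => simp only [h0]; rfl
    | 1 => simp only [h1]; rfl
    | 2 => simp only [h2]; rfl
    | n + 3 =>
      have : (quadraticInY d A M).coeff (n + 3) = 0 := by
        apply coeff_eq_zero_of_natDegree_lt
        have : (quadraticInY d A M).natDegree ≤ 2 := by rw [quadraticInY]; exact natDegree_quadratic_le
        omega
      rw [this, coeff_zero, ite_self, if_neg (by omega), if_neg (by omega), if_neg (by omega)]

theorem coeffAt_symm (hA : A.natDegree ≤ d) (hMd : M.natDegree ≤ d) (hM : M.reflect d = M)
    (z : ℤ × ℤ) : coeffAt (quadraticInY d A M) z =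
      coeffAt (quadraticInY d A M) ((d : ℤ) - z.1, ((2 : ℕ) : ℤ) - z.2) := by
  obtain ⟨i, j⟩ := z
  have hMi : intCoeff M i = intCoeff M (d - i) := by
    conv_lhs => rw [← hM]
    rw [intCoeff_reflect hMd]
  have hAi := intCoeff_reflect hA i
  have hAi' := intCoeff_reflect hA (d - i)
  rw [sub_sub_cancel] at hAi'
  rw [coeffAt_quadraticInY, coeffAt_quadraticInY]
  push_cast
  by_cases h0 : j = 0
  · subst h0; simp [hAi]
  by_cases h1 : j = 1
  · subst h1; simpa using hMi
  by_cases h2 : j = 2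
  · subst h2; simp [hAi']
  rw [if_neg h0, if_neg h1, if_neg h2, if_neg (by omega), if_neg (by omega), if_neg (by omega)]

theorem isReciprocal_quadraticInY (hA : A.natDegree ≤ d) (hMd : M.natDegree ≤ d)
    (hM : M.reflect d = M) : IsReciprocal (quadraticInY d A M) :=
  ⟨d, 2, coeffAt_symm hA hMd hM⟩

/-- The central symmetry of the Newton polygon of a reciprocal polynomial maps sides to sides. -/
theorem IsSide.symm {P : ℂ[X][Y]} {m n : ℕ}
    (hP : ∀ z : ℤ × ℤ, coeffAt P z = coeffAt P ((m : ℤ) - z.1, (n : ℤ) - z.2))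
    {p v : ℤ × ℤ} {N : ℕ} (h : IsSide P p v N) :
    IsSide P ((m : ℤ) - p.1, (n : ℤ) - p.2) (-v) N := by
  have hshift : ∀ k : ℕ, (((m : ℤ) - p.1, (n : ℤ) - p.2) + k • (-v) : ℤ × ℤ) =
      ((m : ℤ) - (p + k • v).1, (n : ℤ) - (p + k • v).2) := by
    intro k
    ext <;> simp <;> ring
  refine ⟨by simpa using h.primitive, h.length_pos, ?_, ?_, ?_, ?_⟩
  · rw [← hP]; exact h.start_mem
  · rw [hshift, ← hP]; exact h.end_mem
  · intro z hz
    rw [hP] at hz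
    have := h.left _ hz
    simp only [Prod.fst_neg, Prod.snd_neg] at this ⊢
    linarith
  · intro z hz hl
    rw [hP] at hz
    obtain ⟨k, hk, hzk⟩ := h.on_line _ hz (by
      simp only [Prod.fst_neg, Prod.snd_neg] at hl ⊢
      linarith)
    refine ⟨k, hk, ?_⟩
    rw [hshift, ← hzk]
    ext <;> simp

theorem facePolynomial_symm {P : ℂ[X][Y]} {m n : ℕ}
    (hP : ∀ z : ℤ × ℤ, coeffAt P z = coeffAt P ((m : ℤ) - z.1, (n : ℤ) - z.2))
    (p v : ℤ × ℤ) (N : ℕ) :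
    facePolynomial P ((m : ℤ) - p.1, (n : ℤ) - p.2) (-v) N = facePolynomial P p v N := by
  refine Finset.sum_congr rfl fun k _ => ?_
  rw [hP (p + k • v)]
  congr 3
  ext <;> simp <;> ring

theorem exists_pow_eq_one_of_quadratic {b t : ℂ} (hb : b = 0 ∨ b = 1 ∨ b = 2)
    (ht : 1 + b * t + t ^ 2 = 0) : ∃ n : ℕ, 0 < n ∧ t ^ n = 1 := by
  rcases hb with rfl | rfl | rfl
  · exact ⟨4, by norm_num, by linear_combination (t ^ 2 - 1) * ht⟩
  · exact ⟨3, by norm_num, by linear_combination (t - 1) * ht⟩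
  · have h : (1 + t) ^ 2 = 0 := by linear_combination ht
    have h' : t = -1 := by linear_combination eq_zero_of_pow_eq_zero h
    exact ⟨2, by norm_num, by rw [h']; norm_num⟩

theorem exists_pow_eq_one_of_linear {t : ℂ} (ht : 1 + t = 0) : ∃ n : ℕ, 0 < n ∧ t ^ n = 1 :=
  ⟨2, by norm_num, by linear_combination (t - 1) * ht⟩

theorem eval_facePolynomial (P : ℂ[X][Y]) (p v : ℤ × ℤ) (N : ℕ) (t : ℂ) :
    (facePolynomial P p v N).eval t =
      ∑ n ∈ Finset.range (N + 1), coeffAt P (p + n • v) * t ^ n := by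
  simp [facePolynomial, eval_finsetSum]

theorem coeff_facePolynomial (P : ℂ[X][Y]) (p v : ℤ × ℤ) (N n : ℕ) :
    (facePolynomial P p v N).coeff n = if n ≤ N then coeffAt P (p + n • v) else 0 := by
  simp only [facePolynomial, finsetSum_coeff, coeff_C_mul_X_pow]
  simp

theorem reflect_eq_X_pow_mul_facePolynomial {i N : ℕ}
    (h : ∀ m : ℕ, (A.reflect d).coeff m ≠ 0 → i ≤ m ∧ m ≤ i + N) :
    A.reflect d = X ^ i * facePolynomial (quadraticInY d A M) ((i : ℤ), 0) (1, 0) N := by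
  ext m
  rw [coeff_X_pow_mul']
  split_ifs with him
  · obtain ⟨n, rfl⟩ := Nat.exists_eq_add_of_le him
    rw [Nat.add_sub_cancel_left, coeff_facePolynomial]
    have h1 : (((i : ℤ), 0) + n • (1, 0) : ℤ × ℤ) = (((i + n : ℕ) : ℤ), 0) := by
      ext <;> simp
    split_ifs with hn
    · rw [h1, coeffAt_quadraticInY, if_pos rfl, intCoeff_natCast]
    · by_contra h0
      have := h _ h0
      omega
  · by_contra h0
    exact him (h _ h0).1

/-- The left boundary descends from `(0, 2)` to `(e, 0)`, with a vertex at `(0, 1)` if that point is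
present and `e > 0`. If it is absent, then `e ≤ 1`: the segment crosses the middle row at `e/2 < 1`,
so no point of that row lies on it. -/
theorem downward_side_cases {s : ℤ → ℤ → Prop} {p1 p2 v1 v2 : ℤ} {N : ℕ}
    (hsupp : ∀ i j, s i j → 0 ≤ i ∧ ((j = 0 ∧ e ≤ i) ∨ j = 1 ∨ j = 2)) (h2 : s 0 2) (h0 : s e 0)
    (h1 : ¬ s 0 1 → e ≤ 1) (hN : 0 < N) (hv : v2 < 0) (hstart : s p1 p2)
    (hend : s (p1 + N * v1) (p2 + N * v2))
    (hleft : ∀ i j, s i j → 0 ≤ v1 * (j - p2) - v2 * (i - p1))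
    (hline : ∀ i j, s i j → v1 * (j - p2) - v2 * (i - p1) = 0 →
      ∃ n : ℕ, n ≤ N ∧ j = p2 + n * v2) :
    (N = 1 ∧ v2 = -1 ∧ p1 = 0 ∧ p2 = 2 ∧ v1 = 0 ∧ s 0 1 ∧ 0 < e) ∨
    (N = 1 ∧ v2 = -1 ∧ p1 = 0 ∧ p2 = 1 ∧ v1 = e ∧ s 0 1 ∧ 0 < e) ∨
    (N = 1 ∧ v2 = -2 ∧ p1 = 0 ∧ p2 = 2 ∧ v1 = e) ∨
    (N = 2 ∧ v2 = -1 ∧ p1 = 0 ∧ p2 = 2 ∧ v1 = 0 ∧ e = 0) := by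
  obtain ⟨hp1, hp2⟩ := hsupp _ _ hstart
  obtain ⟨hq1, hq2⟩ := hsupp _ _ hend
  have hl2 := hleft _ _ h2
  have hl0 := hleft _ _ h0
  have hNv : (N = 1 ∧ v2 = -1) ∨ (N = 1 ∧ v2 = -2) ∨ (N = 2 ∧ v2 = -1) := by
    have hge : (N : ℤ) * v2 ≥ -2 := by
      generalize (N : ℤ) * v2 = w at *
      omega
    have hle : N ≤ 2 := by
      by_contra h3
      nlinarith
    clear hline hleft hsupp
    interval_cases N <;> omega
  rcases hNv with ⟨rfl, rfl⟩ | ⟨rfl, rfl⟩ | ⟨rfl, rfl⟩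
  · have hne2 : v1 * (2 - p2) - (-1) * (0 - p1) = 0 → 2 = p2 ∨ 2 = p2 - 1 := by
      intro h
      obtain ⟨n, hn, hn'⟩ := hline _ _ h2 h
      interval_cases n <;> omega
    have hne0 : v1 * (0 - p2) - (-1) * (e - p1) = 0 → 0 = p2 ∨ 0 = p2 - 1 := by
      intro h
      obtain ⟨n, hn, hn'⟩ := hline _ _ h0 h
      interval_cases n <;> omega
    have hs1 : s 0 1 ∨ ¬ s 0 1 := em _
    have hl1 := hleft 0 1
    have hend' := hend
    clear hline hleft
    rcases (by omega : p2 = 2 ∨ p2 = 1) with rfl | rfl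
    · rcases hs1 with hs | hs
      · have := hl1 hs
        exact Or.inl ⟨rfl, rfl, by omega, rfl, by omega, hs, by omega⟩
      · exfalso
        have h3 := h1 hs
        have h4 : p1 = 0 := by omega
        have h5 : v1 = 0 := by omega
        apply hs
        simpa [h4, h5] using hend
    · rcases hs1 with hs | hs
      · have := hl1 hs
        exact Or.inr (Or.inl ⟨rfl, rfl, by omega, rfl, by omega, hs, by omega⟩)
      · exfalso
        have h3 := h1 hs
        have h4 : p1 = 0 := by omega
        apply hs
        simpa [h4] using hstart
  · obtain rfl : p2 = 2 := by omega
    exact Or.inr (Or.inr (Or.inl ⟨rfl, rfl, by omega, rfl, by omega⟩))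
  · have hs1 : s 0 1 ∨ ¬ s 0 1 := em _
    have hl1 := hleft 0 1
    clear hline hleft
    obtain rfl : p2 = 2 := by omega
    rcases hs1 with hs | hs
    · have := hl1 hs
      omega
    · have := h1 hs
      omega

/-- The rows `y = 0` and `y = 2` carry `A` up to a power of `x`; along the left boundary the corner
coefficients are `1` and `b = M(0)`. Upward sides and the top side reduce to these by central
symmetry. -/
theorem isTempered_quadraticInY (hA : A.natDegree ≤ d) (hMd : M.natDegree ≤ d)
    (hM : M.reflect d = M) (hA0 : A.coeff 0 = 1)
    (hroots : ∀ t, A.eval t = 0 → ∃ n : ℕ, 0 < n ∧ t ^ n = 1)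
    (hAe : A.reflect d = X ^ e * A)
    (hb : (e = 0 ∧ (M.coeff 0 = 0 ∨ M.coeff 0 = 1 ∨ M.coeff 0 = 2)) ∨
      (e = 1 ∧ M.coeff 0 = 0) ∨ (1 ≤ e ∧ M.coeff 0 = 1)) :
    IsTempered (quadraticInY d A M) := by
  set P := quadraticInY d A M with hP
  have hsymm := coeffAt_symm hA hMd hM
  rw [← hP] at hsymm
  have c2 : coeffAt P (0, 2) = 1 := by rw [hP, coeffAt_quadraticInY]; simp [intCoeff, hA0]
  have c1 : coeffAt P (0, 1) = M.coeff 0 := by rw [hP, coeffAt_quadraticInY]; simp [intCoeff]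
  have c0 : coeffAt P ((e : ℤ), 0) = 1 := by
    rw [hP, coeffAt_quadraticInY, if_pos rfl, hAe, intCoeff_X_pow_mul, sub_self]
    simp [intCoeff, hA0]
  have hsupp : ∀ i j : ℤ, coeffAt P (i, j) ≠ 0 →
      0 ≤ i ∧ ((j = 0 ∧ e ≤ i) ∨ j = 1 ∨ j = 2) := by
    intro i j hij
    rw [hP, coeffAt_quadraticInY] at hij
    have h0 : intCoeff (A.reflect d) i ≠ 0 → (e : ℤ) ≤ i := by
      rw [hAe, intCoeff_X_pow_mul]
      intro h; by_contra h'; exact h (intCoeff_of_neg _ (by omega))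
    have h1 : ∀ p : ℂ[X], intCoeff p i ≠ 0 → 0 ≤ i := by
      intro p h; by_contra h'; exact h (intCoeff_of_neg _ (by omega))
    split_ifs at hij with h2 h3 h4
    · exact ⟨h1 _ hij, Or.inl ⟨h2, h0 hij⟩⟩
    · exact ⟨h1 _ hij, by tauto⟩
    · exact ⟨h1 _ hij, by tauto⟩
    · exact absurd rfl hij
  have c2' : coeffAt P (0, 2) ≠ 0 := by rw [c2]; exact one_ne_zero
  have c0' : coeffAt P ((e : ℤ), 0) ≠ 0 := by rw [c0]; exact one_ne_zero
  -- sides directed downwards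
  have hdown : ∀ (p v : ℤ × ℤ) (N : ℕ), IsSide P p v N → v.2 < 0 →
      ∀ t : ℂ, (facePolynomial P p v N).IsRoot t → ∃ n : ℕ, 0 < n ∧ t ^ n = 1 := by
    rintro ⟨p1, p2⟩ ⟨v1, v2⟩ N hs hv t ht
    have hcases := downward_side_cases (s := fun i j => coeffAt P (i, j) ≠ 0) hsupp c2' c0'
      (by
        intro h0
        simp only [c1, ne_eq, not_not] at h0
        rcases hb with h | h | h
        · omega
        · omega
        · rw [h0] at h; exact absurd h.2 zero_ne_one)
      hs.length_pos hv hs.start_mem (by simpa using hs.end_mem) (fun i j => hs.left (i, j))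
      (fun i j hij h0 => by
        obtain ⟨n, hn, h1⟩ := hs.on_line (i, j) hij h0
        exact ⟨n, hn, by simpa using congrArg Prod.snd h1⟩)
    simp only [c1] at hcases
    have hb1 : M.coeff 0 ≠ 0 → 0 < e → M.coeff 0 = 1 := by
      intro h0 h1
      rcases hb with h | h | h
      · omega
      · exact absurd h.2 h0
      · exact h.2
    rw [IsRoot.def, eval_facePolynomial] at ht
    rcases hcases with ⟨rfl, rfl, rfl, rfl, rfl, h1, he⟩ | ⟨rfl, rfl, rfl, rfl, rfl, h1, he⟩ |
      ⟨rfl, rfl, rfl, rfl, rfl⟩ | ⟨rfl, rfl, rfl, rfl, rfl, he⟩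
    · norm_num [Finset.sum_range_succ, c2, c1, hb1 h1 he] at ht
      exact exists_pow_eq_one_of_linear ht
    · norm_num [Finset.sum_range_succ, c0, c1, hb1 h1 he] at ht
      exact exists_pow_eq_one_of_linear ht
    · norm_num [Finset.sum_range_succ, c2, c0] at ht
      exact exists_pow_eq_one_of_linear ht
    · subst he
      norm_num at c0
      norm_num [Finset.sum_range_succ, c2, c1, c0] at ht
      refine exists_pow_eq_one_of_quadratic ?_ ht
      rcases hb with h | h | h
      · exact h.2
      · omega
      · omega
  have hright : ∀ (p v : ℤ × ℤ) (N : ℕ), IsSide P p v N → v = (1, 0) →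
      ∀ t : ℂ, (facePolynomial P p v N).IsRoot t → ∃ n : ℕ, 0 < n ∧ t ^ n = 1 := by
    rintro ⟨p1, p2⟩ v N hs rfl t ht
    have hl0 := hs.left _ c0'
    have hstart := hs.start_mem
    obtain ⟨hp1, hp2⟩ := hsupp _ _ hstart
    have hp : p2 = 0 := by simp at hl0; omega
    subst hp
    obtain ⟨i, rfl⟩ := Int.eq_ofNat_of_zero_le hp1
    have hrow : ∀ m : ℕ, (A.reflect d).coeff m ≠ 0 → i ≤ m ∧ m ≤ i + N := by
      intro m hm
      obtain ⟨n, hn, hmn⟩ := hs.on_line ((m : ℤ), 0)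
        (by rwa [hP, coeffAt_quadraticInY, if_pos rfl, intCoeff_natCast]) (by simp)
      have := congrArg Prod.fst hmn
      simp at this
      omega
    have ht0 : t ≠ 0 := by
      rintro rfl
      rw [IsRoot.def, ← coeff_zero_eq_eval_zero, coeff_facePolynomial, if_pos (Nat.zero_le _),
        zero_smul, add_zero] at ht
      exact hstart ht
    have h1 := congrArg (eval t) (reflect_eq_X_pow_mul_facePolynomial (M := M) hrow)
    rw [eval_mul, ← hP, ht.eq_zero, mul_zero, hAe, eval_mul, eval_pow, eval_X] at h1
    exact hroots t ((mul_eq_zero.1 h1).resolve_left (pow_ne_zero _ ht0))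
  intro p v N hs t ht
  rcases lt_trichotomy v.2 0 with hv | hv | hv
  · exact hdown p v N hs hv t ht
  · have hg := hs.primitive
    rw [hv, Int.gcd_zero_right, Int.natAbs_eq_iff] at hg
    rcases hg with hg | hg
    · exact hright p v N hs (Prod.ext (by simpa using hg) hv) t ht
    · refine hright _ _ N (hs.symm hsymm) (Prod.ext ?_ ?_) t ?_
      · simp [hg]
      · simp [hv]
      · rwa [facePolynomial_symm hsymm]
  · refine hdown _ _ N (hs.symm hsymm) (by simpa using hv) t ?_
    rwa [facePolynomial_symm hsymm]

end NewtonPolygon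

/-! ### Pencils: finiteness of the degenerate members -/

/-- At such a root, `s` is a critical point of `-r/p` and `k` its value. Critical points are zeros
of the Wronskian; if it vanishes identically, `-r/p` is constant and leaves a single `k`. -/
theorem finite_double_root_linear {p : ℂ[X]} (hp : p ≠ 0) (r : ℂ[X]) :
    {k : ℂ | ∃ s, p.eval s ≠ 0 ∧ k * p.eval s + r.eval s = 0 ∧
      k * (derivative p).eval s + (derivative r).eval s = 0}.Finite := by
  by_cases hW : wronskian p r = 0
  · obtain ⟨p', r', hp', hr', hu⟩ := extract_gcd p r
    set g := gcd p r
    have hg : g ≠ 0 := by rintro h0; rw [h0, zero_mul] at hp'; exact hp hp'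
    have hcop : IsCoprime p' r' := gcd_isUnit_iff _ _ |>.1 hu
    have hW' : wronskian p' r' = 0 := by
      apply mul_left_cancel₀ (pow_ne_zero 2 hg)
      rw [mul_zero, ← hW, hp', hr', wronskian, wronskian, derivative_mul, derivative_mul]
      ring
    obtain ⟨h1, h2⟩ := hcop.wronskian_eq_zero_iff.1 hW'
    obtain ⟨a, ha⟩ := natDegree_eq_zero.1 (derivative_eq_zero.1 h1)
    obtain ⟨b, hb⟩ := natDegree_eq_zero.1 (derivative_eq_zero.1 h2)
    refine (Set.finite_singleton (-b / a)).subset ?_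
    rintro k ⟨s, hs, hk, -⟩
    rw [hp', ← ha, eval_mul, eval_C] at hs hk
    rw [hr', ← hb, eval_mul, eval_C] at hk
    obtain ⟨hgs, has⟩ := mul_ne_zero_iff.1 hs
    rw [Set.mem_singleton_iff, eq_div_iff has]
    apply mul_left_cancel₀ hgs
    linear_combination hk
  · refine ((wronskian p r).roots.toFinset.finite_toSet.image
      fun s => -r.eval s / p.eval s).subset ?_
    rintro k ⟨s, hs, hk, hk'⟩
    refine ⟨s, ?_, ?_⟩
    · simp only [Finset.mem_coe, Multiset.mem_toFinset, mem_roots hW, IsRoot.def]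
      rw [wronskian, eval_sub, eval_mul, eval_mul]
      linear_combination p.eval s * hk' - (derivative p).eval s * hk
    · simp only
      rw [div_eq_iff hs]
      linear_combination -hk

/-- A double root of the product is a double root of one factor or a common root; the latter is a
root of `r₁ - r₂` and determines `k`. -/
theorem finite_double_root_mul {p r₁ r₂ : ℂ[X]} (hp : p ≠ 0) (hr : r₁ ≠ r₂) :
    {k : ℂ | ∃ s, p.eval s ≠ 0 ∧ ((C k * p + r₁) * (C k * p + r₂)).eval s = 0 ∧
      (derivative ((C k * p + r₁) * (C k * p + r₂))).eval s = 0}.Finite := by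
  have hroots : {k : ℂ | ∃ s, p.eval s ≠ 0 ∧ r₁.eval s = r₂.eval s ∧
      k * p.eval s + r₁.eval s = 0}.Finite := by
    refine ((r₁ - r₂).roots.toFinset.finite_toSet.image
      fun s => -r₁.eval s / p.eval s).subset ?_
    rintro k ⟨s, hs, hk, hk'⟩
    refine ⟨s, ?_, ?_⟩
    · simp only [Finset.mem_coe, Multiset.mem_toFinset, mem_roots (sub_ne_zero.2 hr), IsRoot.def,
        eval_sub, hk, sub_self]
    · simp only
      rw [div_eq_iff hs]
      linear_combination -hk'
  refine ((finite_double_root_linear hp r₁).union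
    ((finite_double_root_linear hp r₂).union hroots)).subset ?_
  rintro k ⟨s, hs, h0, h1⟩
  simp only [derivative_mul, derivative_add, derivative_C, eval_mul, eval_add, eval_C, zero_mul,
    zero_add] at h0 h1
  rcases mul_eq_zero.1 h0 with h | h
  · rw [h, zero_mul, add_zero] at h1
    rcases mul_eq_zero.1 h1 with h2 | h2
    · exact Or.inl ⟨s, hs, h, h2⟩
    · exact Or.inr (Or.inr ⟨s, hs, by linear_combination h - h2, h⟩)
  · rw [h, mul_zero, zero_add] at h1
    rcases mul_eq_zero.1 h1 with h2 | h2
    · exact Or.inr (Or.inr ⟨s, hs, by linear_combination h2 - h, h2⟩)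
    · exact Or.inr (Or.inl ⟨s, hs, h, h2⟩)

theorem finite_linear_root {a b : ℂ} (h : a ≠ 0 ∨ b ≠ 0) : {k : ℂ | 2 * k * a + b = 0}.Finite := by
  refine (Set.finite_singleton (-b / (2 * a))).subset ?_
  intro k hk
  simp only [Set.mem_ofPred_eq] at hk
  have ha : a ≠ 0 := by
    rintro rfl
    rw [mul_zero, zero_add] at hk
    tauto
  rw [Set.mem_singleton_iff, eq_div_iff (mul_ne_zero two_ne_zero ha)]
  linear_combination hk

/-- The polynomials `q_k(t) = k² (t² - 4) + 2 k N(t) + R(t)`. -/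
def quadraticPencil (N R : ℂ[X]) (k : ℂ) : ℂ[X] := C (k ^ 2) * (X ^ 2 - 4) + C (2 * k) * N + R

/-- The conditions on `q` for `v² = x⁴ q(x + 1 / x)` to have genus 3. -/
structure IsGoodQuartic (q : ℂ[X]) : Prop where
  squarefree : Squarefree q
  le_natDegree : 3 ≤ q.natDegree
  natDegree_le : q.natDegree ≤ 4
  eval_two : q.eval 2 ≠ 0
  eval_neg_two : q.eval (-2) ≠ 0

theorem eval_quadraticPencil (N R : ℂ[X]) (k t : ℂ) : (quadraticPencil N R k).eval t =
    k ^ 2 * (t ^ 2 - 4) + 2 * k * N.eval t + R.eval t := by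
  simp [quadraticPencil]

theorem exists_double_root {q : ℂ[X]} (h : ¬ Squarefree q) :
    ∃ t, q.eval t = 0 ∧ (derivative q).eval t = 0 := by
  have h1 : ¬ ∀ c : ℂ, ¬ (X - C c) ^ 2 ∣ q := fun h0 => h (squarefree_of_forall_not_sq_dvd h0)
  push Not at h1
  obtain ⟨t, r, rfl⟩ := h1
  exact ⟨t, by simp, by simp [derivative_mul, derivative_pow]⟩

/-- If, after a substitution `t = θ(s)`, the pencil `q_k` factors into two pencils that are linear
in `k`, then almost all of its members are good. -/
theorem finite_not_isGoodQuartic {N R θ m p r₁ r₂ : ℂ[X]}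
    (hfac : ∀ k, (quadraticPencil N R k).comp θ * m = (C k * p + r₁) * (C k * p + r₂))
    (hθ : ∀ t, t ≠ 2 → t ≠ -2 → ∃ s, θ.eval s = t ∧ p.eval s ≠ 0)
    (hr : r₁ ≠ r₂) (h2 : N.eval 2 ≠ 0 ∨ R.eval 2 ≠ 0) (h2' : N.eval (-2) ≠ 0 ∨ R.eval (-2) ≠ 0)
    (hN : N.natDegree ≤ 4) (hR : R.natDegree ≤ 4) (hNR : 3 ≤ N.natDegree ∨ 3 ≤ R.natDegree) :
    {k | ¬ IsGoodQuartic (quadraticPencil N R k)}.Finite := by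
  have hp : p ≠ 0 := by
    rintro rfl
    obtain ⟨s, -, hs⟩ := hθ 0 (by norm_num) (by norm_num)
    simp at hs
  obtain ⟨i, hi3, hi4, hi⟩ : ∃ i, 3 ≤ i ∧ i ≤ 4 ∧ (N.coeff i ≠ 0 ∨ R.coeff i ≠ 0) := by
    rcases hNR with h | h
    · refine ⟨N.natDegree, h, hN, Or.inl ?_⟩
      rw [coeff_natDegree, leadingCoeff_ne_zero]; rintro rfl; simp at h
    · refine ⟨R.natDegree, h, hR, Or.inr ?_⟩
      rw [coeff_natDegree, leadingCoeff_ne_zero]; rintro rfl; simp at h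
  have hcoeff : ∀ k, (quadraticPencil N R k).coeff i = 2 * k * N.coeff i + R.coeff i := by
    intro k
    -- The `k²` part has degree 2, so in degrees 3 and 4 the coefficients are linear in `k`; it also
    -- vanishes at `t = ±2`.
    have h1 : (X ^ 2 - 4 : ℂ[X]).coeff i = 0 := by
      rw [coeff_eq_zero_of_natDegree_lt]
      exact lt_of_le_of_lt (by compute_degree) (by omega : 2 < i)
    rw [quadraticPencil, coeff_add, coeff_add, coeff_C_mul, coeff_C_mul, h1, mul_zero, zero_add]
  refine ((finite_double_root_mul hp hr).union ((finite_linear_root hi).union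
    ((finite_linear_root h2).union (finite_linear_root h2')))).subset ?_
  intro k hk
  by_contra hgood
  simp only [Set.mem_union, not_or, Set.mem_ofPred_eq] at hgood hk
  obtain ⟨g1, g2, g3, g4⟩ := hgood
  have e2 : (quadraticPencil N R k).eval 2 ≠ 0 := by
    rw [eval_quadraticPencil]
    intro h0; apply g3; linear_combination h0
  have e2' : (quadraticPencil N R k).eval (-2) ≠ 0 := by
    rw [eval_quadraticPencil]
    intro h0; apply g4; linear_combination h0
  apply hk
  refine ⟨?_, ?_, ?_, e2, e2'⟩
  · by_contra hsq
    obtain ⟨t, ht, ht'⟩ := exists_double_root hsq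
    -- A double root of `q_k` avoids `±2`, so it lifts along `θ` to a double root of the factored
    -- product where `p ≠ 0`.
    obtain ⟨s, rfl, hs⟩ := hθ t (by rintro rfl; exact e2 ht) (by rintro rfl; exact e2' ht)
    refine g1 ⟨s, hs, ?_, ?_⟩
    · rw [← hfac, eval_mul, eval_comp, ht, zero_mul]
    · rw [← hfac, derivative_mul, derivative_comp, eval_add, eval_mul, eval_mul, eval_mul,
        eval_comp, eval_comp, ht, ht']
      ring
  · rw [← hcoeff] at g2
    exact hi3.trans (le_natDegree_of_ne_zero g2)
  · rw [quadraticPencil]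
    refine natDegree_add_le_of_degree_le (natDegree_add_le_of_degree_le ?_ ?_) hR
    · compute_degree!
    · exact (natDegree_C_mul_le _ _).trans hN

/-! ### The factor `A` and the common discriminant computation -/

theorem palindromize_coeff_zero (n : ℕ) (q : ℂ[X]) : (palindromize n q).coeff 0 = q.coeff n := by
  rw [coeff_zero_eq_eval_zero, palindromize, eval_finsetSum, Finset.sum_eq_single n]
  · simp
  · intro i hi hin
    have : n - i ≠ 0 := by have := Finset.mem_range.1 hi; omega
    simp [this]
  · simp

theorem reflect_eq_of_forall_eval {p r : ℂ[X]} {d : ℕ} (hp : p.natDegree ≤ d)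
    (h : ∀ c ≠ 0, c ^ d * p.eval c⁻¹ = r.eval c) : p.reflect d = r := by
  apply eq_of_forall_eval_eq
  intro c hc
  rw [← h c hc]
  simpa using aeval_reflect hc hp

/-- A palindromic polynomial of even degree is a polynomial in `x + 1 / x`. -/
theorem exists_palindromize_eq (n : ℕ) {A : ℂ[X]} (hA : A.natDegree ≤ 2 * n)
    (hrefl : A.reflect (2 * n) = A) : ∃ a : ℂ[X], a.natDegree ≤ n ∧ palindromize n a = A := by
  induction n generalizing A with
  | zero =>
    refine ⟨A, by omega, ?_⟩
    rw [palindromize]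
    simp only [zero_add, Finset.range_one, Finset.sum_singleton, pow_zero, mul_one, Nat.sub_self]
    exact (eq_C_of_natDegree_eq_zero (by omega)).symm
  | succ n ih =>
    -- Removing the top term `A(0) t^(n+1)` kills both extreme coefficients; dividing by `x` leaves
    -- a palindromic polynomial for `n`.
    set G := A - C (A.coeff 0) * (X ^ 2 + 1) ^ (n + 1) with hG
    have hXd : ((X ^ 2 + 1) ^ (n + 1) : ℂ[X]).natDegree ≤ 2 * (n + 1) := by
      refine natDegree_pow_le.trans ?_
      rw [mul_comm]
      exact Nat.mul_le_mul_right _ (by compute_degree)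
    have hXr : ((X ^ 2 + 1) ^ (n + 1) : ℂ[X]).reflect (2 * (n + 1)) = (X ^ 2 + 1) ^ (n + 1) := by
      apply reflect_eq_of_forall_eval hXd
      intro c hc
      simp only [eval_pow, eval_add, eval_X, eval_one, pow_mul]
      rw [← mul_pow]
      congr 1
      field_simp
      ring
    have hGd : G.natDegree ≤ 2 * (n + 1) :=
        (natDegree_sub_le_of_le hA ((natDegree_C_mul_le _ _).trans hXd)).trans (max_self _).le
    have hGr : G.reflect (2 * (n + 1)) = G := by
      rw [hG, reflect_sub, reflect_C_mul, hXr, hrefl]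
    have hG0 : G.coeff 0 = 0 := by
      rw [hG, coeff_sub, coeff_C_mul, coeff_zero_eq_eval_zero ((X ^ 2 + 1) ^ (n + 1))]
      simp
    have hGi : ∀ i ≤ 2 * (n + 1), G.coeff (2 * (n + 1) - i) = G.coeff i := by
      intro i hi
      conv_rhs => rw [← hGr, coeff_reflect, revAt_le hi]
    have hX : X * G.divX = G := by
      have := X_mul_divX_add G
      rwa [hG0, C_0, add_zero] at this
    have hd : G.divX.natDegree ≤ 2 * n := by
      rw [natDegree_le_iff_coeff_eq_zero]
      intro i hi
      rw [coeff_divX]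
      rcases (by omega : i = 2 * n + 1 ∨ 2 * (n + 1) ≤ i) with rfl | h
      · have := hGi 0 (by omega)
        rwa [hG0] at this
      · exact coeff_eq_zero_of_natDegree_lt (by omega)
    obtain ⟨a, had, ha⟩ := ih hd (by
      ext i
      rw [coeff_reflect]
      rcases le_or_gt i (2 * n) with h | h
      · rw [revAt_le h, coeff_divX, coeff_divX, ← hGi (i + 1) (by omega)]
        congr 1; omega
      · rw [revAt_eq_self_of_lt h])
    have hdeg : (a + C (A.coeff 0) * X ^ (n + 1)).natDegree ≤ n + 1 :=
      natDegree_add_le_of_degree_le (by omega) (natDegree_C_mul_X_pow_le _ _)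
    refine ⟨a + C (A.coeff 0) * X ^ (n + 1), hdeg, ?_⟩
    apply eq_of_forall_eval_eq
    intro c hc
    have h1 := congrArg (eval c) hX
    rw [← ha, eval_mul, eval_palindromize hc had, hG] at h1
    simp only [eval_X, eval_sub, eval_mul, eval_C, eval_pow, eval_add, eval_one] at h1
    rw [eval_palindromize hc hdeg]
    simp only [eval_X, eval_mul, eval_C, eval_pow, eval_add]
    have h2 : c ^ 2 + 1 = c * (c + c⁻¹) := by field_simp
    rw [h2, mul_pow] at h1
    linear_combination h1

theorem polynomial_four_ne_zero : (4 : ℂ[X]) ≠ 0 := by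
  rw [← map_ofNat (C : ℂ →+* ℂ[X]) 4]
  exact C_ne_zero.2 (by norm_num)

/-- `A` is palindromic of degree `2 * n` with constant coefficient `1`, its roots are roots of
unity, and `A(x) = x ^ n * a(x + 1 / x)`. -/
structure PalindromicFactor (n : ℕ) (A a : ℂ[X]) : Prop where
  natDegree_A : A.natDegree ≤ 2 * n
  natDegree_a : a.natDegree ≤ n
  eq : palindromize n a = A
  coeff_zero : A.coeff 0 = 1
  roots : ∀ t, A.eval t = 0 → ∃ m : ℕ, 0 < m ∧ t ^ m = 1
  reflect_A : A.reflect (2 * n) = A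

namespace PalindromicFactor

variable {n d e : ℕ} {A a : ℂ[X]}

theorem coeff_a (h : PalindromicFactor n A a) : a.coeff n = 1 := by
  rw [← palindromize_coeff_zero, h.eq, h.coeff_zero]

theorem a_ne_zero (h : PalindromicFactor n A a) : a ≠ 0 := by
  rintro rfl; simpa using h.coeff_a

theorem A_ne_zero (h : PalindromicFactor n A a) : A ≠ 0 := by
  rintro rfl; simpa using h.coeff_zero

theorem eval_A (h : PalindromicFactor n A a) {c : ℂ} (hc : c ≠ 0) :
    A.eval c = c ^ n * a.eval (c + c⁻¹) := by
  rw [← h.eq, eval_palindromize hc h.natDegree_a]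

theorem eval_two (h : PalindromicFactor n A a) : a.eval 2 = A.eval 1 := by
  rw [h.eval_A one_ne_zero]; norm_num

theorem eval_neg_two (h : PalindromicFactor n A a) : a.eval (-2) = (-1) ^ n * A.eval (-1) := by
  rw [h.eval_A (by norm_num), ← mul_assoc, ← mul_pow]; norm_num

theorem reflect_A' (h : PalindromicFactor n A a) : A.reflect (e + 2 * n) = X ^ e * A := by
  have h1 := reflect_mul (1 : ℂ[X]) A (F := e) (G := 2 * n) (by simp) h.natDegree_A
  rwa [one_mul, ← C_1, reflect_C, C_1, one_mul, h.reflect_A] at h1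

theorem of_isCyclotomicProduct (hA : IsCyclotomicProduct A) (hrec : A.reverse = A)
    (hn : A.natDegree = 2 * n) : ∃ a, PalindromicFactor n A a := by
  obtain ⟨s, hs, hAs⟩ := hA
  have hmonic : A.Monic := by
    rw [hAs]; exact monic_multiset_prod_of_monic _ _ fun m _ => cyclotomic.monic m ℂ
  have hrefl : A.reflect (2 * n) = A := by rw [← hn]; exact hrec
  obtain ⟨a, had, ha⟩ := exists_palindromize_eq n hn.le hrefl
  refine ⟨a, hn.le, had, ha, ?_, ?_, hrefl⟩
  · rw [← hrec, coeff_zero_reverse, hmonic.leadingCoeff]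
  · intro t ht
    rw [hAs, eval_multiset_prod, Multiset.prod_eq_zero_iff] at ht
    simp only [Multiset.mem_map, exists_exists_and_eq_and] at ht
    obtain ⟨m, hm, hmt⟩ := ht
    have hm0 := hs m hm
    have : NeZero (m : ℂ) := ⟨by exact_mod_cast hm0.ne'⟩
    exact ⟨m, hm0, (isRoot_cyclotomic_iff.1 hmt).pow_eq_one⟩

theorem condition (h : PalindromicFactor n A a) {S N R : ℂ[X]} {M : ℂ → ℂ[X]} (hd : e + 2 * n = d)
    (hMd : ∀ k, (M k).natDegree ≤ d) (hMr : ∀ k, (M k).reflect d = M k)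
    (hM0 : ∀ k, (e = 0 ∧ ((M k).coeff 0 = 0 ∨ (M k).coeff 0 = 1 ∨ (M k).coeff 0 = 2)) ∨
      (e = 1 ∧ (M k).coeff 0 = 0) ∨ (1 ≤ e ∧ (M k).coeff 0 = 1))
    (hSd : S.natDegree ≤ d) (hS0 : S ≠ 0) (hSr : S.reflect d = -(X ^ 4 * S))
    (hcop : ∀ c, A.eval c = 0 → S.eval c ≠ 0)
    (hgood : {k | ¬ IsGoodQuartic (quadraticPencil N R k)}.Finite)
    (hdisc : ∀ k, (quadraticPencil N R k).natDegree ≤ 4 → ∀ c ≠ 0,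
      (M k).eval c ^ 2 - 4 * c ^ d * a.eval (c + c⁻¹) ^ 2 =
        S.eval c ^ 2 * (c ^ 4 * (quadraticPencil N R k).eval (c + c⁻¹))) :
    Condition fun k => quadraticInY d A (M k) := by
  have hAd : A.natDegree ≤ d := h.natDegree_A.trans (by omega)
  have hmodel : ∀ k, IsGoodQuartic (quadraticPencil N R k) →
      HyperellipticModel d e A (M k) S (quadraticPencil N R k) := by
    intro k hk
    refine ⟨hAd, hMd k, hSd, h.A_ne_zero, hS0, hcop, ?_, hMr k, hSr, ?_, hk.squarefree,
      hk.le_natDegree, hk.natDegree_le, hk.eval_two, hk.eval_neg_two⟩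
    · rw [← hd]; exact h.reflect_A'
    · apply eq_of_forall_eval_eq
      intro c hc
      have h1 := hdisc k hk.natDegree_le c hc
      simp only [eval_sub, eval_mul, eval_pow, eval_X, eval_ofNat]
      rw [eval_palindromize hc hk.natDegree_le, ← h1, h.eval_A hc, ← hd]
      ring
  refine ⟨fun k => ?_, fun k => isReciprocal_quadraticInY hAd (hMd k) (hMr k),
    hgood.subset fun k hk hk' => hk ?_, hgood.subset fun k hk hk' => hk ?_⟩
  · refine isTempered_quadraticInY hAd (hMd k) (hMr k) h.coeff_zero h.roots ?_ (hM0 k)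
    rw [← hd]; exact h.reflect_A'
  · exact (hmodel k hk').definesCurveOfGenus_and_quotientHasGenus.1
  · exact (hmodel k hk').definesCurveOfGenus_and_quotientHasGenus.2

/-- Since `(x + 1)² = x (t + 2)`, the discriminant is `x⁵ ((t + 2)(k(t - 2) + N)² - 4a²)`. The
condition on `N(2)` makes the bracket divisible by `t - 2 = (x - 1)²/x`, whence `S = x - 1` and `(t
- 2) R = (t + 2) N² - 4a²`. -/
theorem condition_odd (h : PalindromicFactor n A a) {N : ℂ[X]} {M : ℂ → ℂ[X]} {δ : ℂ}
    (hd : e + 2 * n = 5) (hδ : δ ^ 2 = 1) (hA1 : A.eval 1 ≠ 0) (hA1' : A.eval (-1) ≠ 0)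
    (hN2 : N.eval 2 = δ * A.eval 1) (hNd : N.natDegree ≤ 2)
    (hT : 4 ≤ ((X + 2) * N ^ 2 - 4 * a ^ 2).natDegree)
    (hMd : ∀ k, (M k).natDegree ≤ 5)
    (hM0 : ∀ k, (e = 1 ∧ (M k).coeff 0 = 0) ∨ (1 ≤ e ∧ (M k).coeff 0 = 1))
    (hM : ∀ k, ∀ c ≠ 0, (M k).eval c =
      (c + 1) * c ^ 2 * (k * (c + c⁻¹ - 2) + N.eval (c + c⁻¹))) :
    Condition fun k => quadraticInY 5 A (M k) := by
  have hδ0 : δ ≠ 0 := by rintro rfl; norm_num at hδ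
  obtain ⟨R, hR⟩ : X - C 2 ∣ (X + 2) * N ^ 2 - 4 * a ^ 2 := by
    rw [dvd_iff_isRoot, IsRoot.def]
    simp only [eval_sub, eval_mul, eval_add, eval_pow, eval_X, eval_ofNat, h.eval_two, hN2]
    linear_combination 4 * A.eval 1 ^ 2 * hδ
  have hRe : ∀ t, (t - 2) * R.eval t = (t + 2) * N.eval t ^ 2 - 4 * a.eval t ^ 2 := by
    intro t
    have := congrArg (eval t) hR
    simp only [eval_sub, eval_mul, eval_add, eval_pow, eval_X, eval_ofNat, eval_C] at this
    exact this.symm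
  have hR0 : R ≠ 0 := by rintro rfl; rw [hR] at hT; simp at hT
  have hRd : ((X + 2) * N ^ 2 - 4 * a ^ 2).natDegree = 1 + R.natDegree := by
    rw [hR, natDegree_mul (X_sub_C_ne_zero _) hR0, natDegree_X_sub_C]
  have hTd : ((X + 2) * N ^ 2 - 4 * a ^ 2 : ℂ[X]).natDegree ≤ 5 := by
    have h1 : (X + 2 : ℂ[X]).natDegree ≤ 1 := by compute_degree
    have h2 : (N ^ 2).natDegree ≤ 4 := (natDegree_pow_le_of_le 2 hNd)
    have h3 : (a ^ 2).natDegree ≤ 5 :=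
      (natDegree_pow_le_of_le 2 h.natDegree_a).trans (by omega)
    have h4 : (4 * a ^ 2).natDegree ≤ 5 := by
      rw [show (4 : ℂ[X]) = C 4 from (map_ofNat C 4).symm]
      exact (natDegree_C_mul_le _ _).trans h3
    exact (natDegree_sub_le_of_le (natDegree_mul_le_of_le h1 h2) h4).trans (by norm_num)
  have hS0 : (X - 1 : ℂ[X]) ≠ 0 := by simpa using X_sub_C_ne_zero (1 : ℂ)
  refine h.condition (S := X - 1) (N := (X + 2) * N) (R := R) hd hMd (fun k => ?_)
    (fun k => Or.inr (hM0 k)) (by compute_degree!) hS0 ?_ ?_ ?_ ?_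
  · apply reflect_eq_of_forall_eval (hMd k)
    intro c hc
    rw [hM k c hc, hM k c⁻¹ (inv_ne_zero hc), inv_inv, add_comm c⁻¹ c]
    field_simp
    ring
  · apply reflect_eq_of_forall_eval (by compute_degree!)
    intro c hc
    simp only [eval_sub, eval_X, eval_one, eval_neg, eval_mul, eval_pow]
    field_simp
    ring
  · intro c hc h0
    have : c = 1 := by simpa [sub_eq_zero] using h0
    exact hA1 (this ▸ hc)
  · have hc : ((X : ℂ[X]) ^ 2 - 2).natDegree = 2 := by compute_degree!
    -- The substitution `t = s² - 2` makes `t + 2` a square, so that `(t - 2) q_k` becomes a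
    -- difference of squares.
    refine finite_not_isGoodQuartic (θ := X ^ 2 - 2) (m := X ^ 2 - 4) (p := X * (X ^ 2 - 4))
      (r₁ := X * N.comp (X ^ 2 - 2) - 2 * a.comp (X ^ 2 - 2))
      (r₂ := X * N.comp (X ^ 2 - 2) + 2 * a.comp (X ^ 2 - 2)) (fun k => ?_) (fun t ht ht' => ?_)
      ?_ (Or.inl ?_) (Or.inr ?_) ?_ (by omega) (Or.inr (by omega))
    · apply Polynomial.funext
      intro s
      have := hRe (s ^ 2 - 2)
      simp only [eval_mul, eval_comp, eval_quadraticPencil, eval_sub, eval_add, eval_pow, eval_X,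
        eval_ofNat, eval_C]
      linear_combination this
    · obtain ⟨s, hs⟩ := IsAlgClosed.exists_pow_nat_eq (t + 2) (n := 2) (by norm_num)
      refine ⟨s, by simp [hs], ?_⟩
      simp only [eval_mul, eval_X, eval_sub, eval_pow, eval_ofNat, hs]
      apply mul_ne_zero
      · rintro rfl
        apply ht'
        linear_combination -hs
      · intro h0
        apply ht
        linear_combination h0
    · intro h0
      have h4 : 4 * a.comp (X ^ 2 - 2) = 0 := by linear_combination -h0
      have h1 := (mul_eq_zero.1 h4).resolve_left polynomial_four_ne_zero
      have h2 : a ≠ 0 := h.a_ne_zero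
      rcases comp_eq_zero_iff.1 h1 with h3 | h3
      · exact h2 h3
      · have := congrArg natDegree h3.2
        rw [natDegree_C] at this
        omega
    · simp only [eval_mul, eval_add, eval_X, eval_ofNat, hN2]
      exact mul_ne_zero (by norm_num) (mul_ne_zero hδ0 hA1)
    · intro h0
      have h1 := hRe (-2)
      have h2 : a.eval (-2) ≠ 0 := by
        rw [h.eval_neg_two]
        exact mul_ne_zero (pow_ne_zero _ (by norm_num)) hA1'
      rw [h0] at h1
      apply h2
      apply eq_zero_of_pow_eq_zero (n := 2)
      linear_combination (1 / 4 : ℂ) * h1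
    · exact (natDegree_mul_le_of_le (by compute_degree) hNd).trans (by norm_num : 1 + 2 ≤ 4)
  · intro k _ c hc
    rw [hM k c hc, eval_quadraticPencil]
    have := hRe (c + c⁻¹)
    have h1 : (c + 1) ^ 2 = c * (c + c⁻¹ + 2) := by field_simp; ring
    have h2 : (c - 1) ^ 2 = c * (c + c⁻¹ - 2) := by field_simp; ring
    simp only [eval_mul, eval_add, eval_sub, eval_X, eval_one, eval_ofNat]
    rw [h2, mul_pow, mul_pow, h1]
    generalize N.eval (c + c⁻¹) = x at *
    generalize c + c⁻¹ = t at *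
    linear_combination -c ^ 5 * this

/-- The discriminant is `x^(2r) ((k(t² - 4) + N)² - 4a²)`, a difference of squares already in `t`.
The values `N(±2)` make it divisible by `t² - 4 = (x - 1/x)²`, which `S` absorbs, and `(t² - 4) R =
N² - 4a²`. -/
theorem condition_even (h : PalindromicFactor n A a) {N S : ℂ[X]} {M : ℂ → ℂ[X]} {δ₁ δ₂ : ℂ} {r : ℕ}
    (hd : e + 2 * n = 2 * r) (hδ₁ : δ₁ ^ 2 = 1) (hδ₂ : δ₂ ^ 2 = 1)
    (hA1 : A.eval 1 ≠ 0) (hA1' : A.eval (-1) ≠ 0)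
    (hN2 : N.eval 2 = 2 * δ₁ * A.eval 1) (hN2' : N.eval (-2) = -(2 * δ₂ * A.eval (-1)))
    (hNd : N.natDegree ≤ 4) (hT : (N ^ 2 - 4 * a ^ 2).natDegree ≤ 6)
    (hNT : 3 ≤ N.natDegree ∨ 5 ≤ (N ^ 2 - 4 * a ^ 2).natDegree)
    (hMd : ∀ k, (M k).natDegree ≤ 2 * r)
    (hM0 : ∀ k, (e = 0 ∧ ((M k).coeff 0 = 0 ∨ (M k).coeff 0 = 1 ∨ (M k).coeff 0 = 2)) ∨
      (1 ≤ e ∧ (M k).coeff 0 = 1))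
    (hM : ∀ k, ∀ c ≠ 0, (M k).eval c =
      c ^ r * (k * ((c + c⁻¹) ^ 2 - 4) + N.eval (c + c⁻¹)))
    (hSd : S.natDegree ≤ 2 * r) (hS0 : S ≠ 0)
    (hSr : S.reflect (2 * r) = -(X ^ 4 * S))
    (hcop : ∀ c, A.eval c = 0 → S.eval c ≠ 0)
    (hS : ∀ c ≠ 0, S.eval c ^ 2 * c ^ 4 = c ^ (2 * r) * ((c + c⁻¹) ^ 2 - 4)) :
    Condition fun k => quadraticInY (2 * r) A (M k) := by
  have hsign : ((-1 : ℂ) ^ n) ^ 2 = 1 := by rw [← pow_mul, mul_comm, pow_mul]; norm_num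
  obtain ⟨R, hR⟩ : X ^ 2 - 4 ∣ N ^ 2 - 4 * a ^ 2 := by
    have h4 : (X ^ 2 - 4 : ℂ[X]) = (X - C 2) * (X - C (-2)) := by
      have : C (2 : ℂ) * C 2 = 4 := by
        rw [← C_mul, ← map_ofNat (C : ℂ →+* ℂ[X]) 4]; norm_num
      rw [C_neg]
      linear_combination this
    rw [h4]
    apply IsCoprime.mul_dvd
    · exact isCoprime_X_sub_C_of_isUnit_sub (by norm_num)
    · rw [dvd_iff_isRoot, IsRoot.def]
      simp only [eval_sub, eval_mul, eval_pow, eval_ofNat, h.eval_two, hN2]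
      linear_combination 4 * A.eval 1 ^ 2 * hδ₁
    · rw [dvd_iff_isRoot, IsRoot.def]
      simp only [eval_sub, eval_mul, eval_pow, eval_ofNat, h.eval_neg_two, hN2']
      linear_combination 4 * A.eval (-1) ^ 2 * (hδ₂ - hsign)
  have hRe : ∀ t, (t ^ 2 - 4) * R.eval t = N.eval t ^ 2 - 4 * a.eval t ^ 2 := by
    intro t
    have := congrArg (eval t) hR
    simp only [eval_sub, eval_mul, eval_pow, eval_X, eval_ofNat] at this
    exact this.symm
  have hX4 : (X ^ 2 - 4 : ℂ[X]).natDegree = 2 := by compute_degree!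
  have hX0 : (X ^ 2 - 4 : ℂ[X]) ≠ 0 := by intro h0; simp [h0] at hX4
  have hRd : R ≠ 0 → (N ^ 2 - 4 * a ^ 2).natDegree = 2 + R.natDegree := by
    intro hR0
    rw [hR, natDegree_mul hX0 hR0, hX4]
  have hR4 : R.natDegree ≤ 4 := by
    by_cases hR0 : R = 0
    · simp [hR0]
    · have := hRd hR0; omega
  have hNR : 3 ≤ N.natDegree ∨ 3 ≤ R.natDegree := by
    refine hNT.imp_right fun h5 => ?_
    by_cases hR0 : R = 0
    · rw [hR, hR0] at h5; simp at h5
    · have := hRd hR0; omega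
  have hδ₁0 : δ₁ ≠ 0 := by rintro rfl; norm_num at hδ₁
  have hδ₂0 : δ₂ ≠ 0 := by rintro rfl; norm_num at hδ₂
  refine h.condition (S := S) (N := N) (R := R) hd hMd (fun k => ?_)
    (fun k => (hM0 k).imp_right Or.inr) hSd hS0 hSr hcop ?_ ?_
  · apply reflect_eq_of_forall_eval (hMd k)
    intro c hc
    rw [hM k c hc, hM k c⁻¹ (inv_ne_zero hc), inv_inv, add_comm c⁻¹ c, ← mul_assoc]
    congr 1
    rw [inv_pow, two_mul, pow_add]
    field_simp
  · refine finite_not_isGoodQuartic (θ := X) (m := X ^ 2 - 4) (p := X ^ 2 - 4)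
      (r₁ := N - 2 * a) (r₂ := N + 2 * a) (fun k => ?_) (fun t ht ht' => ⟨t, by simp, ?_⟩)
      ?_ (Or.inl ?_) (Or.inl ?_) hNd hR4 hNR
    · apply Polynomial.funext
      intro t
      have := hRe t
      simp only [eval_mul, eval_comp, eval_quadraticPencil, eval_sub, eval_add, eval_pow, eval_X,
        eval_ofNat, eval_C]
      linear_combination this
    · simp only [eval_sub, eval_pow, eval_X, eval_ofNat]
      intro h0
      have : (t - 2) * (t - -2) = 0 := by linear_combination h0
      rcases mul_eq_zero.1 this with h1 | h1
      exacts [ht (sub_eq_zero.1 h1), ht' (sub_eq_zero.1 h1)]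
    · intro h0
      have h4 : 4 * a = 0 := by linear_combination -h0
      exact h.a_ne_zero ((mul_eq_zero.1 h4).resolve_left polynomial_four_ne_zero)
    · rw [hN2]
      exact mul_ne_zero (mul_ne_zero two_ne_zero hδ₁0) hA1
    · rw [hN2', neg_ne_zero]
      exact mul_ne_zero (mul_ne_zero two_ne_zero hδ₂0) hA1'
  · intro k _ c hc
    rw [hM k c hc, eval_quadraticPencil]
    have := hRe (c + c⁻¹)
    have h1 := hS c hc
    generalize N.eval (c + c⁻¹) = x at *
    generalize c + c⁻¹ = t at *
    linear_combination -c ^ (2 * r) * this - (k ^ 2 * (t ^ 2 - 4) + 2 * k * x + eval t R) * h1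

end PalindromicFactor

/-! ### The three families -/

namespace PalindromicFactor

variable {n d e : ℕ} {A a : ℂ[X]}

theorem sq_eq_one {δ : ℂ} (h : δ = 1 ∨ δ = -1) : δ ^ 2 = 1 := by
  rcases h with rfl | rfl <;> norm_num

theorem coeff_four_mul_sq (h : PalindromicFactor n A a) : (4 * a ^ 2).coeff (2 * n) = 4 := by
  rw [← map_ofNat (C : ℂ →+* ℂ[X]) 4, coeff_C_mul, coeff_pow_of_natDegree_le h.natDegree_a,
    h.coeff_a]
  norm_num

theorem natDegree_four_mul_sq_le (h : PalindromicFactor n A a) : (4 * a ^ 2).natDegree ≤ 2 * n := by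
  rw [← map_ofNat (C : ℂ →+* ℂ[X]) 4]
  exact (natDegree_C_mul_le _ _).trans (natDegree_pow_le_of_le 2 h.natDegree_a)

/-- Here `x⁴ + x = (x + 1) x² (t - 1)` and `x³ + x² = (x + 1) x²`, so `N` is constant; the degree 3
of `q_k` comes from `-4a²`. -/
theorem condition_type1_zero (h : PalindromicFactor 2 A a) {δ : ℂ} (hδ : δ = 1 ∨ δ = -1)
    (hA1 : A.eval 1 ≠ 0) (hA1' : A.eval (-1) ≠ 0) :
    Condition fun k => type1 A 0 k (-k - (0 : ℂ[X]).eval 1 / 2 + δ * A.eval 1) := by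
  refine h.condition_odd (e := 1) (N := C (δ * A.eval 1))
    (M := fun k => 0 + C k * (X ^ 4 + X) +
      C (-k - (0 : ℂ[X]).eval 1 / 2 + δ * A.eval 1) * (X ^ 3 + X ^ 2))
    rfl (sq_eq_one hδ) hA1 hA1' (by simp) (natDegree_C _ |>.trans_le (by norm_num)) ?_
    (fun k => by compute_degree!)
    (fun k => Or.inl ⟨rfl, by simp⟩) ?_
  · apply le_natDegree_of_ne_zero
    have h1 : ((X + 2) * C (δ * A.eval 1) ^ 2 : ℂ[X]).coeff 4 = 0 := by
      apply coeff_eq_zero_of_natDegree_lt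
      refine lt_of_le_of_lt ?_ (by norm_num : 1 < 4)
      compute_degree
    rw [coeff_sub, h1, h.coeff_four_mul_sq]
    norm_num
  · intro k c hc
    simp only [eval_add, eval_mul, eval_C, eval_pow, eval_X, eval_zero]
    field_simp
    ring

/-- Here `x⁵ + 1 = (x + 1) x² (t² - t - 1)`, so `N` is monic quadratic and `(t + 2) N²`, of degree
5, dominates `4a²`. -/
theorem condition_type1_one (h : PalindromicFactor n A a) (hn : n ≤ 2) {δ : ℂ}
    (hδ : δ = 1 ∨ δ = -1) (hA1 : A.eval 1 ≠ 0) (hA1' : A.eval (-1) ≠ 0) :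
    Condition fun k => type1 A (X ^ 5 + 1) k
      (-k - (X ^ 5 + 1 : ℂ[X]).eval 1 / 2 + δ * A.eval 1) := by
  have hNd : (X ^ 2 - X - C 2 + C (δ * A.eval 1)).natDegree ≤ 2 := by compute_degree
  refine h.condition_odd (e := 5 - 2 * n) (N := X ^ 2 - X - C 2 + C (δ * A.eval 1))
    (M := fun k => X ^ 5 + 1 + C k * (X ^ 4 + X) +
      C (-k - (X ^ 5 + 1 : ℂ[X]).eval 1 / 2 + δ * A.eval 1) * (X ^ 3 + X ^ 2))
    (by omega) (sq_eq_one hδ) hA1 hA1' ?_ hNd ?_ (fun k => by compute_degree)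
    (fun k => Or.inr ⟨by omega, by simp⟩) ?_
  · simp only [eval_add, eval_sub, eval_pow, eval_X, eval_C]
    ring
  · refine (by norm_num : 4 ≤ 5).trans (le_natDegree_of_ne_zero ?_)
    have h1 : ((X + C 2) * (X ^ 2 - X - C 2 + C (δ * A.eval 1)) ^ 2 : ℂ[X]).coeff (1 + 2 * 2) =
        1 := by
      rw [coeff_mul_add_eq_of_natDegree_le (by compute_degree!) (natDegree_pow_le_of_le 2 hNd),
        coeff_pow_of_natDegree_le hNd]
      simp [coeff_X, -map_mul]
    have h2 : (4 * a ^ 2).coeff 5 = 0 := by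
      apply coeff_eq_zero_of_natDegree_lt
      have := h.natDegree_four_mul_sq_le
      omega
    rw [coeff_sub, h2, ← map_ofNat (C : ℂ →+* ℂ[X]) 2, h1]
    norm_num
  · intro k c hc
    simp only [eval_add, eval_sub, eval_mul, eval_C, eval_pow, eval_X, eval_one]
    field_simp
    ring

theorem sq_sub_one_ne_zero_of_eval_eq_zero (hA1 : A.eval 1 ≠ 0) (hA1' : A.eval (-1) ≠ 0) {c : ℂ}
    (hc : A.eval c = 0) : c ^ 2 - 1 ≠ 0 := by
  intro h0
  have h1 : (c - 1) * (c - -1) = 0 := by linear_combination h0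
  rcases mul_eq_zero.1 h1 with h2 | h2
  · exact hA1 (sub_eq_zero.1 h2 ▸ hc)
  · exact hA1' (sub_eq_zero.1 h2 ▸ hc)

theorem condition_type2 (h : PalindromicFactor n A a) (hn : n ≤ 3) {B : ℂ[X]} {b δ₁ δ₂ : ℂ}
    (hB : B = C b * (X ^ 6 + 1)) (hb : (n = 3 ∧ (b = 0 ∨ b = 1 ∨ b = 2)) ∨ b = 1)
    (hδ₁ : δ₁ = 1 ∨ δ₁ = -1) (hδ₂ : δ₂ = 1 ∨ δ₂ = -1)
    (hA1 : A.eval 1 ≠ 0) (hA1' : A.eval (-1) ≠ 0) :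
    Condition fun k => type2 A B k ((-B.eval 1 + δ₁ * A.eval 1 + δ₂ * A.eval (-1)) / 2)
      (-2 * k + δ₁ * A.eval 1 - δ₂ * A.eval (-1)) := by
  subst hB
  set l := (-(C b * (X ^ 6 + 1)).eval 1 + δ₁ * A.eval 1 + δ₂ * A.eval (-1)) / 2 with hl
  simp only [eval_mul, eval_add, eval_pow, eval_X, eval_C, eval_one, one_pow] at hl
  -- Divide by `x³`: `x⁶ + 1` gives `t³ - 3t`, `x⁵ + x` gives `t² - 2`, and `x⁴ + x²` gives `t`.
  set N : ℂ[X] := C b * X ^ 3 + C (l - 3 * b) * X + C (δ₁ * A.eval 1 - δ₂ * A.eval (-1)) with hN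
  have hN3 : N.natDegree ≤ 3 := by rw [hN]; compute_degree
  refine h.condition_even (e := 6 - 2 * n) (r := 3) (N := N) (S := X ^ 2 - 1)
    (M := fun k => C b * (X ^ 6 + 1) + C k * (X ^ 5 + X) + C l * (X ^ 4 + X ^ 2) +
      C (-2 * k + δ₁ * A.eval 1 - δ₂ * A.eval (-1)) * X ^ 3)
    (by omega) (sq_eq_one hδ₁) (sq_eq_one hδ₂) hA1 hA1' ?_ ?_ (hN3.trans (by norm_num)) ?_ ?_
    (fun k => by compute_degree) (fun k => ?_) (fun k c hc => ?_) (by compute_degree!) ?_ ?_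
    (fun c hc => ?_) (fun c hc => ?_)
  · simp only [hN, eval_add, eval_mul, eval_pow, eval_X, eval_C, hl]
    ring
  · simp only [hN, eval_add, eval_mul, eval_pow, eval_X, eval_C, hl]
    ring
  · refine (natDegree_sub_le_of_le (natDegree_pow_le_of_le 2 hN3)
      (h.natDegree_four_mul_sq_le.trans (by omega : 2 * n ≤ 6))).trans (by norm_num)
  · by_cases hb0 : b = 0
    -- Without the cubic term of `N`, the degree must come from `-4a²`, which requires `deg a = 3`.
    · right
      obtain rfl : n = 3 := by
        rcases hb with h1 | h1
        · exact h1.1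
        · rw [hb0] at h1; norm_num at h1
      refine (by norm_num : 5 ≤ 6).trans (le_natDegree_of_ne_zero ?_)
      have hN2 : N.natDegree ≤ 2 := by
        rw [hN, hb0, C_0, zero_mul, zero_add]; compute_degree!
      rw [coeff_sub, coeff_eq_zero_of_natDegree_lt (p := N ^ 2)
        (lt_of_le_of_lt (natDegree_pow_le_of_le 2 hN2) (by norm_num)), h.coeff_four_mul_sq]
      norm_num
    -- The cubic term of `N` suffices; for `b = 2` the leading terms of `N²` and `4a²` cancel, so
    -- `R` could not be relied on.
    · left
      apply le_natDegree_of_ne_zero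
      rw [hN]
      simp only [coeff_add, coeff_C_mul, coeff_X_pow, coeff_X, coeff_C]
      norm_num [hb0]
  · have h0 : (C b * (X ^ 6 + 1) + C k * (X ^ 5 + X) + C l * (X ^ 4 + X ^ 2) +
        C (-2 * k + δ₁ * A.eval 1 - δ₂ * A.eval (-1)) * X ^ 3 : ℂ[X]).coeff 0 = b := by
      rw [coeff_zero_eq_eval_zero]
      simp
    simp only [h0]
    by_cases hn3 : n = 3
    · exact Or.inl ⟨by omega, by tauto⟩
    · exact Or.inr ⟨by omega, by tauto⟩
  · simp only [hN, eval_add, eval_mul, eval_pow, eval_X, eval_C, eval_one]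
    field_simp
    ring
  · exact (monic_X_pow_sub_C (1 : ℂ) two_ne_zero).ne_zero
  · apply reflect_eq_of_forall_eval (by compute_degree!)
    intro c hc
    simp only [eval_sub, eval_X, eval_one, eval_neg, eval_mul, eval_pow]
    field_simp
    ring
  · simpa using sq_sub_one_ne_zero_of_eval_eq_zero hA1 hA1' hc
  · simp only [eval_sub, eval_X, eval_one, eval_pow]
    field_simp
    ring

theorem condition_type3 (h : PalindromicFactor 4 A a) {δ₁ δ₂ : ℂ}
    (hδ₁ : δ₁ = 1 ∨ δ₁ = -1) (hδ₂ : δ₂ = 1 ∨ δ₂ = -1)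
    (hA1 : A.eval 1 ≠ 0) (hA1' : A.eval (-1) ≠ 0) :
    Condition fun k => type3 A (2 * X ^ 8 + 2) (A.coeff 1) k
      ((-4 * A.coeff 1 + δ₁ * A.eval 1 + δ₂ * A.eval (-1)) / 2)
      (-2 * k - 4 + δ₁ * A.eval 1 - δ₂ * A.eval (-1)) := by
  have hα : a.coeff 3 = A.coeff 1 := by
    rw [← h.eq, palindromize_four]
    simp only [coeff_add, coeff_C_mul, coeff_X_pow, coeff_X, coeff_C]
    norm_num
  set α := A.coeff 1
  set l := (-4 * α + δ₁ * A.eval 1 + δ₂ * A.eval (-1)) / 2 with hl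
  set N : ℂ[X] := C 2 * X ^ 4 + C (2 * α) * X ^ 3 - C 8 * X ^ 2 + C (l - 6 * α) * X +
    C (δ₁ * A.eval 1 - δ₂ * A.eval (-1)) with hN
  have hN4 : N.natDegree ≤ 4 := by rw [hN]; compute_degree
  have hNc4 : N.coeff 4 = 2 := by
    rw [hN]
    simp only [coeff_add, coeff_sub, coeff_C_mul, coeff_X_pow, coeff_X, coeff_C]
    norm_num
  have hNc3 : N.coeff 3 = 2 * α := by
    rw [hN]
    simp only [coeff_add, coeff_sub, coeff_C_mul, coeff_X_pow, coeff_X, coeff_C]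
    norm_num
  have h2a : ∀ i, (2 * a).coeff i = 2 * a.coeff i := fun i => by
    rw [← map_ofNat (C : ℂ →+* ℂ[X]) 2, coeff_C_mul]
  -- The reason for `B = 2x⁸ + 2` and the coefficient `2a` of `x⁷ + x`: the two top coefficients of
  -- `N` and `2a(t)` agree, so `N² - 4a²` drops to degree at most 6 and `R` to degree at most 4.
  have hlow : (N - 2 * a).natDegree ≤ 2 := by
    rw [natDegree_le_iff_coeff_eq_zero]
    intro i hi
    rw [coeff_sub, h2a]
    rcases (by omega : i = 3 ∨ i = 4 ∨ 4 < i) with rfl | rfl | hi4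
    · rw [hNc3, hα, sub_self]
    · rw [hNc4, h.coeff_a]; norm_num
    · rw [coeff_eq_zero_of_natDegree_lt (hN4.trans_lt hi4),
        coeff_eq_zero_of_natDegree_lt (h.natDegree_a.trans_lt hi4)]
      norm_num
  have hhigh : (N + 2 * a).natDegree ≤ 4 := by
    refine natDegree_add_le_of_degree_le hN4 ?_
    rw [← map_ofNat (C : ℂ →+* ℂ[X]) 2]
    exact (natDegree_C_mul_le _ _).trans h.natDegree_a
  refine h.condition_even (e := 0) (r := 4) (N := N) (S := X ^ 3 - X)
    (M := fun k => 2 * X ^ 8 + 2 + C (2 * α) * (X ^ 7 + X) + C k * (X ^ 6 + X ^ 2) +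
      C l * (X ^ 5 + X ^ 3) + C (-2 * k - 4 + δ₁ * A.eval 1 - δ₂ * A.eval (-1)) * X ^ 4)
    rfl (sq_eq_one hδ₁) (sq_eq_one hδ₂) hA1 hA1' ?_ ?_ hN4 ?_ (Or.inl ?_)
    (fun k => by compute_degree) (fun k => Or.inl ⟨rfl, Or.inr (Or.inr ?_)⟩) (fun k c hc => ?_)
    (by compute_degree!) ?_ ?_ (fun c hc => ?_) (fun c hc => ?_)
  · simp only [hN, eval_add, eval_sub, eval_mul, eval_pow, eval_X, eval_C, hl]
    ring
  · simp only [hN, eval_add, eval_sub, eval_mul, eval_pow, eval_X, eval_C, hl]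
    ring
  · rw [show N ^ 2 - 4 * a ^ 2 = (N - 2 * a) * (N + 2 * a) by ring]
    exact natDegree_mul_le_of_le hlow hhigh
  · refine (by norm_num : 3 ≤ 4).trans (le_natDegree_of_ne_zero ?_)
    rw [hNc4]; norm_num
  · rw [coeff_zero_eq_eval_zero]
    simp
  · simp only [hN, eval_add, eval_sub, eval_mul, eval_pow, eval_X, eval_C, eval_ofNat]
    field_simp
    ring
  · intro h0
    have := congrArg (fun p => p.coeff 3) h0
    simp [coeff_X] at this
  · apply reflect_eq_of_forall_eval (by compute_degree!)
    intro c hc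
    simp only [eval_sub, eval_X, eval_neg, eval_mul, eval_pow]
    field_simp
    ring
  · have h1 := sq_sub_one_ne_zero_of_eval_eq_zero hA1 hA1' hc
    have h2 : c ≠ 0 := by
      rintro rfl
      rw [← coeff_zero_eq_eval_zero, h.coeff_zero] at hc
      exact one_ne_zero hc
    have h3 : (X ^ 3 - X : ℂ[X]).eval c = c * (c ^ 2 - 1) := by simp; ring
    rw [h3]
    exact mul_ne_zero h2 h1
  · simp only [eval_sub, eval_X, eval_pow]
    field_simp
    ring

end PalindromicFactor

end Genus3

end

theorem proposition4p1 (A : ℂ[X]) (hA : Genus3.IsCyclotomicProduct A)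
    (hrec : A.reverse = A) (heven : Even A.natDegree) :
    -- first type
    (∀ (B : ℂ[X]) (δ : ℂ), (δ = 1 ∨ δ = -1) →
      ¬ (X + 1 ∣ A) → A.eval 1 ≠ 0 →
      ((B = 0 ∧ A.natDegree = 4) ∨
        (B = X ^ 5 + 1 ∧ (A.natDegree = 0 ∨ A.natDegree = 2 ∨ A.natDegree = 4))) →
      Genus3.Condition fun k =>
        Genus3.type1 A B k (-k - B.eval 1 / 2 + δ * A.eval 1)) ∧
    -- second type
    (∀ (B : ℂ[X]) (δ₁ δ₂ : ℂ), (δ₁ = 1 ∨ δ₁ = -1) → (δ₂ = 1 ∨ δ₂ = -1) →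
      A.eval 1 ≠ 0 → A.eval (-1) ≠ 0 →
      (((B = 0 ∨ B = 2 * X ^ 6 + 2) ∧ A.natDegree = 6) ∨
        (B = X ^ 6 + 1 ∧
          (A.natDegree = 0 ∨ A.natDegree = 2 ∨ A.natDegree = 4 ∨ A.natDegree = 6))) →
      Genus3.Condition fun k =>
        Genus3.type2 A B k ((-B.eval 1 + δ₁ * A.eval 1 + δ₂ * A.eval (-1)) / 2)
          (-2 * k + δ₁ * A.eval 1 - δ₂ * A.eval (-1))) ∧
    -- third type
    (∀ (B : ℂ[X]) (a δ₁ δ₂ : ℂ), (δ₁ = 1 ∨ δ₁ = -1) → (δ₂ = 1 ∨ δ₂ = -1) →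
      A.eval 1 ≠ 0 → A.eval (-1) ≠ 0 →
      A.natDegree = 8 → B = 2 * X ^ 8 + 2 → a = A.coeff 1 →
      Genus3.Condition fun k =>
        Genus3.type3 A B a k ((-4 * a + δ₁ * A.eval 1 + δ₂ * A.eval (-1)) / 2)
          (-2 * k - 4 + δ₁ * A.eval 1 - δ₂ * A.eval (-1))) := by
  obtain ⟨n, hn⟩ := heven
  obtain ⟨α, h⟩ := Genus3.PalindromicFactor.of_isCyclotomicProduct hA hrec
    (by omega : A.natDegree = 2 * n)
  refine ⟨fun B δ hδ hX hA1 hB => ?_, fun B δ₁ δ₂ hδ₁ hδ₂ hA1 hA1' hB => ?_,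
    fun B a δ₁ δ₂ hδ₁ hδ₂ hA1 hA1' h8 hB ha => ?_⟩
  · have hA1' : A.eval (-1) ≠ 0 := by
      intro h0
      apply hX
      have := dvd_iff_isRoot.2 h0
      rwa [C_neg, C_1, sub_neg_eq_add] at this
    rcases hB with ⟨rfl, h4⟩ | ⟨rfl, hd⟩
    · obtain rfl : n = 2 := by omega
      exact h.condition_type1_zero hδ hA1 hA1'
    · exact h.condition_type1_one (by omega) hδ hA1 hA1'
  · have h2 : (C (2 : ℂ) : ℂ[X]) = 2 := map_ofNat C 2
    rcases hB with ⟨rfl | rfl, h6⟩ | ⟨rfl, hd⟩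
    · exact h.condition_type2 (b := 0) (by omega) (by simp) (Or.inl ⟨by omega, by simp⟩) hδ₁ hδ₂
        hA1 hA1'
    · exact h.condition_type2 (b := 2) (by omega) (by rw [h2]; ring)
        (Or.inl ⟨by omega, by simp⟩) hδ₁ hδ₂ hA1 hA1'
    · exact h.condition_type2 (b := 1) (by omega) (by simp) (Or.inr rfl) hδ₁ hδ₂ hA1 hA1'
  · subst hB ha
    obtain rfl : n = 4 := by omega
    exact h.condition_type3 hδ₁ hδ₂ hA1 hA1'
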